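/- **Proposition 1.2.** Let $\Gamma=\{(\tau,\xi)\in\mathbb R\times\mathbb R^2 : 1+\tau^2=|\xi|^2\}$, equipped with the Lorentz-invariant measure $\sigma$ given by $$\int_\Gamma f\,d\sigma=\int_{|\xi|>1}\Big(f\big(-\sqrt{|\xi|^2-1},\,\xi\big)+f\big(\sqrt{|\xi|^2-1},\,\xi\big)\Big)\frac{d\xi}{\sqrt{|\xi|^2-1}},$$ and let $\mathcal E f(t,x)=\int_\Gamma e^{i(t\tau+x\cdot\xi)}f(\tau,\xi)\,d\sigma(\tau,\xi)$ for $(t,x)\in\mathbb R\times\mathbb R^2$. For $p,q\in(0,\infty]$, say that $\mathcal R^*(p\to q)$ holds if there is a finite constant $C$ such that $\|\mathcal E f\|_{L^q(\mathbb R^3)}\le C\|f\|_{L^p(\Gamma;d\sigma)}$ for every complex-valued $f\in C^\infty_c(\mathbb R^3)$. Let $$T=\{(p^{-1},q^{-1}) : p,q\in[1,\infty],\ 2p'\le q\le 3p',\ q\ge p\},\qquad \tfrac1p+\tfrac1{p'}=1.$$ Then $\mathcal R^*(p\to q)$ fails for $(p,q)=(3,3)$ and $(p,q)=(4,4)$,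 and it fails for all $p,q\in(0,\infty]$ such that $(p^{-1},q^{-1})\notin T$. -/

import Mathlib

open scoped ENNReal NNReal ContDiff

/-- The plane `ℝ²` with its Euclidean norm and Lebesgue measure. -/
abbrev Plane : Type := EuclideanSpace ℝ (Fin 2)

/-- Space-time `ℝ^{1+2}`, with points `(t, x)` (or `(τ, ξ)` on the frequency side);
its `volume` is Lebesgue measure. -/
abbrev Spacetime : Type := ℝ × Plane

/-- `√(|ξ|² - 1)`, to be used for `|ξ| ≥ 1`. -/
noncomputable def hypBracket (ξ : Plane) : ℝ := Real.sqrt (‖ξ‖ ^ 2 - 1)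

/-- The measure `dξ / √(|ξ|² - 1)` on `{ξ ∈ ℝ² : |ξ| > 1}`. -/
noncomputable def baseMeasure : MeasureTheory.Measure Plane :=
  (MeasureTheory.volume.restrict {ξ : Plane | 1 < ‖ξ‖}).withDensity
    (fun ξ => ENNReal.ofReal (hypBracket ξ)⁻¹)

/-- The Lorentz-invariant measure `σ` on the one-sheeted hyperboloid
`Γ = {(τ, ξ) : 1 + τ² = |ξ|²}`, regarded as a measure on `ℝ^{1+2}` carried by `Γ`:
`∫ f dσ = ∫_{|ξ| > 1} (f (-√(|ξ|² - 1), ξ) + f (√(|ξ|² - 1), ξ)) dξ / √(|ξ|² - 1)`. -/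
noncomputable def hyperboloidMeasure : MeasureTheory.Measure Spacetime :=
  baseMeasure.map (fun ξ => (-hypBracket ξ, ξ)) + baseMeasure.map (fun ξ => (hypBracket ξ, ξ))

/-- The Fourier extension operator
`ℰ f (t, x) = ∫ exp (i (t, x) · (τ, ξ)) f (τ, ξ) dσ(τ, ξ)`. -/
noncomputable def extensionOp (f : Spacetime → ℂ) (z : Spacetime) : ℂ :=
  ∫ ζ, Complex.exp (Complex.I * ((z.1 * ζ.1 + inner ℝ z.2 ζ.2 : ℝ) : ℂ)) * f ζ
    ∂hyperboloidMeasure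

/-- `ℛ*(p → q)`: there is a finite constant `C` with `‖ℰ f‖_{L^q(ℝ³)} ≤ C ‖f‖_{L^p(Γ; dσ)}`
for all smooth compactly supported `f` on `ℝ³`. -/
def ExtensionBound (p q : ℝ≥0∞) : Prop :=
  ∃ C : ℝ≥0, ∀ f : Spacetime → ℂ, ContDiff ℝ ∞ f → HasCompactSupport f →
    MeasureTheory.eLpNorm (extensionOp f) q MeasureTheory.volume
      ≤ C * MeasureTheory.eLpNorm f p hyperboloidMeasure

/-- The triangle `T` of all `(1/p, 1/q)`, with `p, q ∈ [1, ∞]` and `1/p + 1/p' = 1`, such that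
`2 p' ≤ q ≤ 3 p'` and `q ≥ p`. -/
def exponentTriangle : Set (ℝ≥0∞ × ℝ≥0∞) :=
  {z | ∃ p p' q : ℝ≥0∞, p.HolderConjugate p' ∧ 2 * p' ≤ q ∧ q ≤ 3 * p' ∧ p ≤ q ∧
    z = (p⁻¹, q⁻¹)}

/-! In null coordinates `ρ = τ + ξ₀`, `s = ξ₁ / ρ`, the part `ρ > 1` of the hyperboloid is a graph
over the half-plane. There `σ` becomes Lebesgue measure `dρ ds`, and after a linear change of
physical variables `(v, x, u)` the phase is `u ρ + x ρ s + v (1/ρ - ρ s²)`. Necessary conditions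
need only test functions living in this chart, so `ExtensionBound` is replaced by `ChartBound`.

Two families of rescalings turn the chart inequality into one for a simpler surface. Parabolic
zooming at a point gives the saddle `r² - s²`, with constant proportional to `λ ^ (2 - 4/q - 2/p)`.
Zooming out isotropically gives the cone, with constant proportional to `λ ^ (3/q + 1/p - 1)`. Here
`λ → ∞`. If the exponent is negative, Fatou forces the limiting extension to vanish, which an
explicit Gaussian contradicts; this gives `q ≥ 2p'` and `q ≤ 3p'`. If the exponent is zero, the
limiting inequality itself must hold. It is zero for the saddle at `(3, 3)` and for the cone at `(4,
4)`, and in both cases the explicit extension of an admissible amplitude has a logarithmically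
divergent norm.

For `q ≥ p` the noncompact group of Lorentz boosts is used. Adding to `g` a boosted copy with
disjoint support, modulated so that its extension is translated far away, multiplies the `L^p` norm
by `2^{1/p}` and asymptotically the `L^q` norm by at least `2^{1/q}`. If `q < p`, this improves the
constant by a fixed factor (`ChartBound.doubling`); iteration makes the constant zero, and the
saddle limit is again contradictory.

The limiting argument is `ChartBound.eLpNorm_rescaling_limit`; the transfer to the chart is
`ExtensionBound.exists_chartBound`. -/

open MeasureTheory Set Filter Topology

/-! ### Null coordinates on the hyperboloid -/

/-- The coordinate `ξ₀ - τ` of the point of `Γ` with `ρ = τ + ξ₀` and `s = ξ₁ / ρ`. -/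
noncomputable def nullHeight (w : ℝ × ℝ) : ℝ := 1 / w.1 - w.1 * w.2 ^ 2

/-- The coordinates `(ξ₀, ξ₁)` of the point of `Γ` with null coordinates `w = (ρ, s)`. -/
noncomputable def chartBase (w : ℝ × ℝ) : ℝ × ℝ := ((w.1 + nullHeight w) / 2, w.1 * w.2)

/-- The coordinate `τ` of the point of `Γ` with null coordinates `w = (ρ, s)`. -/
noncomputable def chartHeight (w : ℝ × ℝ) : ℝ := (w.1 - nullHeight w) / 2

/-- The point of `Γ` with null coordinates `w = (ρ, s)`. -/
noncomputable def chartPoint (w : ℝ × ℝ) : Spacetime :=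
  (chartHeight w, !₂[(chartBase w).1, (chartBase w).2])

/-- The domain `{ρ > 1}` of the null coordinates `(ρ, s)`. -/
def chartDomain : Set (ℝ × ℝ) := {w | 1 < w.1}

lemma isOpen_chartDomain : IsOpen chartDomain := isOpen_lt continuous_const continuous_fst

lemma measurable_nullHeight : Measurable nullHeight := by
  unfold nullHeight; fun_prop

lemma measurable_chartPoint : Measurable chartPoint := by
  have := measurable_nullHeight
  have h : Measurable fun w : ℝ × ℝ => ![(w.1 + nullHeight w) / 2, w.1 * w.2] := by
    rw [measurable_pi_iff]
    intro i
    fin_cases i <;> simp <;> fun_prop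
  exact Measurable.prodMk (by unfold chartHeight; fun_prop)
    ((MeasurableEquiv.toLp 2 (Fin 2 → ℝ)).measurable.comp h)

lemma chartHeight_pos {w : ℝ × ℝ} (hw : w ∈ chartDomain) : 0 < chartHeight w := by
  have h : 1 < w.1 := hw
  have h1 : 1 / w.1 < 1 := by rw [div_lt_one (by linarith)]; exact h
  have : 0 ≤ w.1 * w.2 ^ 2 := by positivity
  unfold chartHeight nullHeight
  linarith

lemma chartBase_sq {w : ℝ × ℝ} (hw : w ∈ chartDomain) :
    (chartBase w).1 ^ 2 + (chartBase w).2 ^ 2 = 1 + chartHeight w ^ 2 := by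
  have h : w.1 ≠ 0 := (zero_lt_one.trans (show 1 < w.1 from hw)).ne'
  unfold chartBase chartHeight nullHeight
  field_simp
  ring

lemma chartBase_add_chartHeight (w : ℝ × ℝ) : chartHeight w + (chartBase w).1 = w.1 := by
  unfold chartBase chartHeight; ring

lemma sqrt_chartBase {w : ℝ × ℝ} (hw : w ∈ chartDomain) :
    Real.sqrt ((chartBase w).1 ^ 2 + (chartBase w).2 ^ 2 - 1) = chartHeight w := by
  rw [chartBase_sq hw, add_sub_cancel_left, Real.sqrt_sq (chartHeight_pos hw).le]

/-- On `ρ > 1` the height `τ` is positive, so the base point determines it as a square root, and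
then `ρ = τ + ξ₀` is known as well. -/
lemma injOn_chartBase : InjOn chartBase chartDomain := by
  intro w hw w' hw' h
  have h1 : w.1 = w'.1 := by
    rw [← chartBase_add_chartHeight w, ← chartBase_add_chartHeight w', ← sqrt_chartBase hw,
      ← sqrt_chartBase hw', h]
  have h2 : w.1 * w.2 = w'.1 * w'.2 := congrArg Prod.snd h
  have h0 : w'.1 ≠ 0 := (zero_lt_one.trans (show 1 < w'.1 from hw')).ne'
  rw [h1] at h2
  exact Prod.ext h1 (mul_left_cancel₀ h0 h2)

/-- The derivative of `chartBase`. -/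
noncomputable def fderivChartBase (w : ℝ × ℝ) : ℝ × ℝ →L[ℝ] ℝ × ℝ :=
  (Matrix.toLin (.finTwoProd ℝ) (.finTwoProd ℝ)
    !![(1 - 1 / w.1 ^ 2 - w.2 ^ 2) / 2, - (w.1 * w.2); w.2, w.1]).toContinuousLinearMap

lemma hasFDerivAt_chartBase {w : ℝ × ℝ} (hw : w ∈ chartDomain) :
    HasFDerivAt chartBase (fderivChartBase w) w := by
  have h0 : w.1 ≠ 0 := (zero_lt_one.trans (show 1 < w.1 from hw)).ne'
  unfold fderivChartBase
  rw [Matrix.toLin_finTwoProd_toContinuousLinearMap]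
  have hf : HasFDerivAt (fun w : ℝ × ℝ => w.1) (ContinuousLinearMap.fst ℝ ℝ ℝ) w := hasFDerivAt_fst
  have hs : HasFDerivAt (fun w : ℝ × ℝ => w.2) (ContinuousLinearMap.snd ℝ ℝ ℝ) w := hasFDerivAt_snd
  have hi := (hasDerivAt_inv h0).comp_hasFDerivAt w hf
  have h1 := ((hf.add (hi.sub (hf.mul (hs.pow 2)))).mul_const (2⁻¹ : ℝ))
  have h2 := hf.mul hs
  have h3 := h1.prodMk h2
  refine (h3.congr_of_eventuallyEq (Eventually.of_forall fun w => ?_)).congr_fderiv ?_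
  · simp [chartBase, nullHeight, div_eq_mul_inv]
  · ext <;> simp <;> field_simp <;> ring

/-- This Jacobian is exactly what cancels the density `1 / √(|ξ|² - 1) = 1 / τ` of the invariant
measure. -/
lemma det_fderivChartBase {w : ℝ × ℝ} (hw : w ∈ chartDomain) :
    (fderivChartBase w).det = chartHeight w := by
  have h0 : w.1 ≠ 0 := (zero_lt_one.trans (show 1 < w.1 from hw)).ne'
  unfold fderivChartBase
  simp only [LinearMap.det_toContinuousLinearMap, LinearMap.det_toLin, Matrix.det_fin_two_of]
  unfold chartHeight nullHeight
  field_simp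
  ring

/-- The part `{τ + ξ₀ > 1}` of space-time. -/
def chartRegion : Set Spacetime := {z | 1 < z.1 + z.2 0}

lemma measurableSet_chartRegion : MeasurableSet chartRegion := by
  refine (isOpen_lt continuous_const ?_).measurableSet
  fun_prop

lemma image_chartBase (A : Set Spacetime) :
    chartBase '' (chartDomain ∩ chartPoint ⁻¹' A) =
      {y | 1 < y.1 ^ 2 + y.2 ^ 2 ∧
        ((Real.sqrt (y.1 ^ 2 + y.2 ^ 2 - 1), !₂[y.1, y.2]) : Spacetime) ∈ A ∩ chartRegion} := by
  ext y
  constructor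
  · rintro ⟨w, ⟨hw, hA⟩, rfl⟩
    have hp := chartHeight_pos hw
    refine ⟨by rw [chartBase_sq hw]; nlinarith, ?_⟩
    rw [sqrt_chartBase hw]
    refine ⟨hA, ?_⟩
    simpa [chartRegion, chartDomain, chartBase_add_chartHeight] using hw
  · rintro ⟨h1, hA, hR⟩
    set t := Real.sqrt (y.1 ^ 2 + y.2 ^ 2 - 1) with ht
    have ht2 : t ^ 2 = y.1 ^ 2 + y.2 ^ 2 - 1 := Real.sq_sqrt (by linarith)
    have hρ : 1 < t + y.1 := by simpa [chartRegion] using hR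
    have h0 : t + y.1 ≠ 0 := by linarith
    have hw : ((t + y.1, y.2 / (t + y.1)) : ℝ × ℝ) ∈ chartDomain := hρ
    have hn : nullHeight (t + y.1, y.2 / (t + y.1)) = y.1 - t := by
      unfold nullHeight
      field_simp
      linarith
    have hb : chartBase (t + y.1, y.2 / (t + y.1)) = y := by
      unfold chartBase
      rw [hn]
      ext
      · simp only; ring
      · simp only; field_simp
    have hh : chartHeight (t + y.1, y.2 / (t + y.1)) = t := by
      unfold chartHeight
      rw [hn]; ring
    refine ⟨_, ⟨hw, ?_⟩, hb⟩
    simp only [mem_preimage, chartPoint, hb, hh]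
    exact hA

/-- The Cartesian coordinates of the plane. -/
def planeCoords (ξ : Plane) : ℝ × ℝ := (ξ 0, ξ 1)

lemma measurePreserving_planeCoords : MeasurePreserving planeCoords := by
  have h := (volume_preserving_finTwoArrow ℝ).comp
    (PiLp.volume_preserving_ofLp (Fin 2))
  exact h

lemma norm_sq_plane (ξ : Plane) : ‖ξ‖ ^ 2 = ξ 0 ^ 2 + ξ 1 ^ 2 := by
  rw [EuclideanSpace.norm_sq_eq]; simp

lemma measurable_hypBracket : Measurable hypBracket := by
  unfold hypBracket; fun_prop

/-- In null coordinates the Lorentz-invariant measure is Lebesgue measure. -/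
theorem hyperboloidMeasure_restrict_chartRegion :
    hyperboloidMeasure.restrict chartRegion = (volume.restrict chartDomain).map chartPoint := by
  have hD : MeasurableSet chartDomain := isOpen_chartDomain.measurableSet
  have hb := measurable_hypBracket
  have hm : Measurable fun ξ : Plane => ((hypBracket ξ, ξ) : Spacetime) := hb.prodMk measurable_id
  have hm' : Measurable fun ξ : Plane => ((-hypBracket ξ, ξ) : Spacetime) :=
    hb.neg.prodMk measurable_id
  have hN : MeasurableSet {ξ : Plane | 1 < ‖ξ‖} := measurableSet_lt measurable_const measurable_norm
  ext A hA
  have hAR := hA.inter measurableSet_chartRegion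
  rw [Measure.restrict_apply hA, Measure.map_apply measurable_chartPoint hA,
    Measure.restrict_apply (measurable_chartPoint hA), hyperboloidMeasure, Measure.add_apply,
    Measure.map_apply hm' hAR, Measure.map_apply hm hAR, baseMeasure,
    withDensity_apply _ (hm' hAR), withDensity_apply _ (hm hAR),
    Measure.restrict_restrict (hm' hAR), Measure.restrict_restrict (hm hAR)]
  -- The lower sheet misses the region: with `h = hypBracket ξ`, `ξ₀ > 1 + h` would give `ξ₀² > 1 +
  -- h² = |ξ|²`.
  have hempty : (fun ξ : Plane => ((-hypBracket ξ, ξ) : Spacetime)) ⁻¹' (A ∩ chartRegion) ∩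
      {ξ : Plane | 1 < ‖ξ‖} = ∅ := by
    ext ξ
    simp only [mem_inter_iff, mem_preimage, mem_ofPred_eq, mem_empty_iff_false, iff_false, not_and,
      chartRegion]
    rintro ⟨-, h⟩ hξ
    have h1 : 0 ≤ ‖ξ‖ ^ 2 - 1 := by nlinarith
    have h2 : hypBracket ξ ^ 2 = ‖ξ‖ ^ 2 - 1 := Real.sq_sqrt h1
    have h3 : 0 ≤ hypBracket ξ := Real.sqrt_nonneg _
    rw [norm_sq_plane] at h2
    nlinarith [sq_nonneg (ξ 1)]
  rw [hempty, Measure.restrict_empty, lintegral_zero_measure, zero_add]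
  set B := chartDomain ∩ chartPoint ⁻¹' A with hB
  have hBm : MeasurableSet B := hD.inter (measurable_chartPoint hA)
  have hcv := lintegral_image_eq_lintegral_abs_det_fderiv_mul volume hBm
    (fun w hw => (hasFDerivAt_chartBase hw.1).hasFDerivWithinAt) (injOn_chartBase.mono inter_subset_left)
    (fun y => ENNReal.ofReal (Real.sqrt (y.1 ^ 2 + y.2 ^ 2 - 1))⁻¹)
  have hR : ∫⁻ w in B, ENNReal.ofReal |(fderivChartBase w).det| *
      ENNReal.ofReal (Real.sqrt ((chartBase w).1 ^ 2 + (chartBase w).2 ^ 2 - 1))⁻¹ = volume B := by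
    rw [setLIntegral_congr_fun hBm (g := fun _ => 1), setLIntegral_one]
    intro w hw
    have hp := chartHeight_pos hw.1
    simp only
    rw [det_fderivChartBase hw.1, sqrt_chartBase hw.1, abs_of_pos hp,
      ← ENNReal.ofReal_mul hp.le, mul_inv_cancel₀ hp.ne', ENNReal.ofReal_one]
  have hI : MeasurableSet (chartBase '' B) :=
    measurable_image_of_fderivWithin hBm
      (fun w hw => (hasFDerivAt_chartBase hw.1).hasFDerivWithinAt)
      (injOn_chartBase.mono inter_subset_left)
  rw [hR] at hcv
  rw [inter_comm _ chartDomain, ← hB, ← hcv, ← measurePreserving_planeCoords.setLIntegral_comp_preimage hI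
    (by fun_prop)]
  congr 1
  · congr 1
    rw [image_chartBase]
    ext ξ
    have h1 : (1 < ‖ξ‖) ↔ 1 < ξ 0 ^ 2 + ξ 1 ^ 2 := by
      rw [← norm_sq_plane]
      exact (one_lt_sq_iff₀ (norm_nonneg _)).symm
    have h2 : (!₂[ξ 0, ξ 1] : Plane) = ξ := by
      ext i; fin_cases i <;> rfl
    simp only [mem_inter_iff, mem_preimage, mem_ofPred_eq, planeCoords, h1, h2, hypBracket,
      norm_sq_plane]
    tauto
  · funext ξ
    simp only [hypBracket, norm_sq_plane, planeCoords]

/-! ### Oscillatory integrals and transfer of the inequality to the chart -/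

/-- The oscillatory integral operator with phase `φ` and amplitude `g`. -/
noncomputable def oscillatoryIntegral (φ : ℝ × ℝ × ℝ → ℝ × ℝ → ℝ) (g : ℝ × ℝ → ℂ)
    (z : ℝ × ℝ × ℝ) : ℂ :=
  ∫ w, Complex.exp (Complex.I * (φ z w : ℂ)) * g w

lemma norm_exp_I_mul_ofReal_mul (x : ℝ) (c : ℂ) : ‖Complex.exp (Complex.I * (x : ℂ)) * c‖ = ‖c‖ := by
  rw [norm_mul, Complex.norm_exp_I_mul_ofReal, one_mul]

lemma stronglyMeasurable_oscillatoryIntegral {φ : ℝ × ℝ × ℝ → ℝ × ℝ → ℝ} {g : ℝ × ℝ → ℂ}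
    (hφ : Measurable (Function.uncurry φ)) (hg : Measurable g) :
    StronglyMeasurable (oscillatoryIntegral φ g) := by
  have : Measurable (Function.uncurry fun z w => Complex.exp (Complex.I * (φ z w : ℂ)) * g w) :=
    ((measurable_const.mul (Complex.measurable_ofReal.comp hφ)).cexp).mul (hg.comp measurable_snd)
  exact this.stronglyMeasurable.integral_prod_right

/-- Dominated convergence with majorant `‖G‖`. Where `G` vanishes so do all the `g n`, hence the
phases need to converge only where `G ≠ 0`. -/
lemma tendsto_oscillatoryIntegral {φ : ℕ → ℝ × ℝ × ℝ → ℝ × ℝ → ℝ} {φ' : ℝ × ℝ × ℝ → ℝ × ℝ → ℝ}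
    {g : ℕ → ℝ × ℝ → ℂ} {G : ℝ × ℝ → ℂ} (hφ : ∀ n, Measurable (Function.uncurry (φ n)))
    (hg : ∀ n, Measurable (g n)) (hG : Integrable G) (hle : ∀ n w, ‖g n w‖ ≤ ‖G w‖)
    (hlim : ∀ w, G w ≠ 0 → Tendsto (fun n => g n w) atTop (𝓝 (G w)))
    (hφlim : ∀ z w, G w ≠ 0 → Tendsto (fun n => φ n z w) atTop (𝓝 (φ' z w))) (z : ℝ × ℝ × ℝ) :
    Tendsto (fun n => oscillatoryIntegral (φ n) (g n) z) atTop
      (𝓝 (oscillatoryIntegral φ' G z)) := by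
  refine tendsto_integral_of_dominated_convergence (fun w => ‖G w‖) (fun n => ?_) hG.norm
    (fun n => Eventually.of_forall fun w => ?_) (Eventually.of_forall fun w => ?_)
  · have h1 : Measurable (φ n z) := (hφ n).comp measurable_prodMk_left
    have h2 := hg n
    exact (((measurable_const.mul (Complex.measurable_ofReal.comp h1)).cexp).mul
      h2).aestronglyMeasurable
  · rw [norm_exp_I_mul_ofReal_mul]
    exact hle n w
  · by_cases hw : G w = 0
    · have : ∀ n, g n w = 0 := fun n => by
        have := hle n w
        rw [hw, norm_zero] at this
        exact norm_le_zero_iff.mp this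
      simp [this, hw]
    · refine Tendsto.mul ?_ (hlim w hw)
      have := (Complex.continuous_ofReal.tendsto _).comp (hφlim z w hw)
      exact (this.const_mul Complex.I).cexp

/-- The phase `t τ + x · ξ` in null coordinates. -/
noncomputable def chartPhase (z : ℝ × ℝ × ℝ) (w : ℝ × ℝ) : ℝ :=
  z.2.2 * w.1 + z.2.1 * (w.1 * w.2) + z.1 * nullHeight w

lemma measurable_chartPhase : Measurable (Function.uncurry chartPhase) := by
  have := measurable_nullHeight
  unfold chartPhase
  have h : Measurable fun p : (ℝ × ℝ × ℝ) × (ℝ × ℝ) => nullHeight p.2 := this.comp measurable_snd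
  unfold Function.uncurry
  fun_prop

/-- Smooth amplitudes compactly supported in the chart domain. -/
def IsChartAmplitude (g : ℝ × ℝ → ℂ) : Prop :=
  ContDiff ℝ ∞ g ∧ ∃ K ⊆ chartDomain, IsCompact K ∧ Function.support g ⊆ K

/-- The extension inequality with constant `C`, in null coordinates. -/
def ChartBound (p q C : ℝ≥0∞) : Prop :=
  ∀ g, IsChartAmplitude g →
    eLpNorm (oscillatoryIntegral chartPhase g) q volume ≤ C * eLpNorm g p volume

instance : Measure.IsAddHaarMeasure (volume : Measure (ℝ × ℝ)) :=
  Measure.prod.instIsAddHaarMeasure _ _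

instance : Measure.IsAddHaarMeasure (volume : Measure (ℝ × ℝ × ℝ)) :=
  Measure.prod.instIsAddHaarMeasure _ _

instance : Measure.IsAddHaarMeasure (volume : Measure Spacetime) :=
  Measure.prod.instIsAddHaarMeasure _ _

/-- A linear change of variables multiplies `L^q` norms by a constant. -/
lemma exists_eLpNorm_comp_eq {E F : Type*} [NormedAddCommGroup E] [NormedSpace ℝ E]
    [FiniteDimensional ℝ E] [MeasureSpace E] [BorelSpace E]
    [Measure.IsAddHaarMeasure (volume : Measure E)]
    [NormedAddCommGroup F] [NormedSpace ℝ F]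
    [FiniteDimensional ℝ F] [MeasureSpace F] [BorelSpace F]
    [Measure.IsAddHaarMeasure (volume : Measure F)] (L : E ≃L[ℝ] F) (q : ℝ≥0∞) :
    ∃ c : ℝ≥0∞, c ≠ 0 ∧ c ≠ ⊤ ∧ ∀ f : F → ℂ, eLpNorm (fun x => f (L x)) q volume =
      c * eLpNorm f q volume := by
  have : Measure.IsAddHaarMeasure ((volume : Measure E).map L) := L.isAddHaarMeasure_map _
  have : ProperSpace F := FiniteDimensional.proper ℝ F
  set c : ℝ≥0∞ :=
    ENNReal.ofNNReal
      (Measure.addHaarScalarFactor ((volume : Measure E).map L) (volume : Measure F))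
  have h0 : c ≠ 0 := ENNReal.coe_ne_zero.mpr
    (Measure.addHaarScalarFactor_pos_of_isAddHaarMeasure _ _).ne'
  have ht : c ≠ ⊤ := ENNReal.coe_ne_top
  have h : (volume : Measure E).map L = c • (volume : Measure F) :=
    Measure.isAddLeftInvariant_eq_smul _ _
  refine ⟨c ^ (1 / q).toReal, ?_, ?_, fun f => ?_⟩
  · exact (ENNReal.rpow_pos (pos_iff_ne_zero.mpr h0) ht).ne'
  · exact ENNReal.rpow_ne_top_of_nonneg ENNReal.toReal_nonneg ht
  · have h1 := L.toHomeomorph.measurableEmbedding.eLpNorm_map_measure (g := f) (p := q)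
      (μ := (volume : Measure E))
    have h2 : (volume : Measure E).map L.toHomeomorph = c • volume := h
    rw [h2, eLpNorm_smul_measure_of_ne_zero h0, smul_eq_mul] at h1
    exact h1.symm

/-- Null coordinates on the physical side. -/
noncomputable def nullCoords : Spacetime ≃L[ℝ] ℝ × ℝ × ℝ :=
  LinearEquiv.toContinuousLinearEquiv
    { toFun := fun z => ((z.2 0 - z.1) / 2, z.2 1, (z.1 + z.2 0) / 2)
      invFun := fun y => (y.2.2 - y.1, !₂[y.2.2 + y.1, y.2.1])
      map_add' := fun z z' => by ext <;> simp <;> ring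
      map_smul' := fun c z => by ext <;> simp <;> ring
      left_inv := fun z => by
        refine Prod.ext (by simp only; ring) ?_
        ext i
        fin_cases i
        · simp; ring
        · simp
      right_inv := fun y => by
        ext
        · simp
        · simp
        · simp }

lemma nullCoords_apply (z : Spacetime) :
    nullCoords z = ((z.2 0 - z.1) / 2, z.2 1, (z.1 + z.2 0) / 2) := rfl

/-- The ambient function on space-time with chart amplitude `g`, cut off by `χ` in the variable
`ξ₀ - τ`. -/
noncomputable def liftAmplitude (g : ℝ × ℝ → ℂ) (χ : ℝ → ℝ) (z : Spacetime) : ℂ :=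
  g (z.1 + z.2 0, z.2 1 / (z.1 + z.2 0)) * (χ (z.2 0 - z.1) : ℂ)

lemma support_liftAmplitude_subset {g : ℝ × ℝ → ℂ} {χ : ℝ → ℝ} {K : Set (ℝ × ℝ)} {J : Set ℝ}
    (hK : K ⊆ chartDomain) (hg : Function.support g ⊆ K) (hχ : Function.support χ ⊆ J) :
    Function.support (liftAmplitude g χ) ⊆
      (fun p : (ℝ × ℝ) × ℝ => (((p.1.1 - p.2) / 2, WithLp.toLp 2 ![(p.1.1 + p.2) / 2, p.1.1 * p.1.2]) :
        Spacetime)) '' (K ×ˢ J) := by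
  intro z hz
  have h : g (z.1 + z.2 0, z.2 1 / (z.1 + z.2 0)) ≠ 0 ∧ χ (z.2 0 - z.1) ≠ 0 := by
    constructor
    · intro h
      apply hz
      simp [liftAmplitude, h]
    · intro h
      apply hz
      simp [liftAmplitude, h]
  have hd : 1 < z.1 + z.2 0 := hK (hg h.1)
  have h0 : z.1 + z.2 0 ≠ 0 := by linarith
  refine ⟨((z.1 + z.2 0, z.2 1 / (z.1 + z.2 0)), z.2 0 - z.1), ⟨hg h.1, hχ h.2⟩, ?_⟩
  refine Prod.ext (by simp only; ring) ?_
  ext i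
  fin_cases i
  · simp; ring
  · simp; field_simp

lemma hasCompactSupport_liftAmplitude {g : ℝ × ℝ → ℂ} {χ : ℝ → ℝ} (hg : IsChartAmplitude g)
    (hχ : HasCompactSupport χ) : HasCompactSupport (liftAmplitude g χ) := by
  obtain ⟨-, K, hKD, hK, hgK⟩ := hg
  refine HasCompactSupport.of_support_subset_isCompact ?_
    (support_liftAmplitude_subset hKD hgK (subset_tsupport χ))
  refine (hK.prod hχ).image ?_
  refine Continuous.prodMk (by fun_prop) ?_
  refine (PiLp.continuous_toLp 2 _).comp ?_
  refine continuous_pi fun i => ?_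
  fin_cases i <;> simp <;> fun_prop

/-- The quotient by `τ + ξ₀` is harmless: `g` is supported in `ρ > 1`, so the lift vanishes near `τ
+ ξ₀ = 0`. -/
lemma contDiff_liftAmplitude {g : ℝ × ℝ → ℂ} {χ : ℝ → ℝ} (hg : IsChartAmplitude g)
    (hχ : ContDiff ℝ ∞ χ) : ContDiff ℝ ∞ (liftAmplitude g χ) := by
  obtain ⟨hgs, K, hKD, hK, hgK⟩ := hg
  have c0 : ContDiff ℝ ∞ fun z : Spacetime => z.2 0 := by fun_prop
  have c1 : ContDiff ℝ ∞ fun z : Spacetime => z.2 1 := by fun_prop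
  have ct : ContDiff ℝ ∞ fun z : Spacetime => z.1 := contDiff_fst
  have cc : ContDiff ℝ ∞ fun z : Spacetime => (χ (z.2 0 - z.1) : ℂ) :=
    Complex.ofRealCLM.contDiff.comp (hχ.comp (c0.sub ct))
  rw [contDiff_iff_contDiffAt]
  intro z
  by_cases h0 : z.1 + z.2 0 = 0
  · have : liftAmplitude g χ =ᶠ[𝓝 z] fun _ => 0 := by
      have ho : IsOpen {z : Spacetime | z.1 + z.2 0 < 1} :=
        isOpen_lt (by fun_prop) continuous_const
      filter_upwards [ho.mem_nhds (show z.1 + z.2 0 < 1 by rw [h0]; norm_num)] with y hy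
      have : g (y.1 + y.2 0, y.2 1 / (y.1 + y.2 0)) = 0 := by
        by_contra hne
        exact absurd (hKD (hgK hne)) (not_lt.mpr (le_of_lt hy))
      simp [liftAmplitude, this]
    exact contDiffAt_const.congr_of_eventuallyEq this
  · refine ContDiffAt.mul ?_ cc.contDiffAt
    exact hgs.contDiffAt.comp z ((ct.add c0).contDiffAt.prodMk
      (c1.contDiffAt.div (ct.add c0).contDiffAt h0))

lemma liftAmplitude_chartPoint {g : ℝ × ℝ → ℂ} {χ : ℝ → ℝ} {K : Set (ℝ × ℝ)}
    (hg : Function.support g ⊆ K) (hχ : ∀ w ∈ K, χ (nullHeight w) = 1) {w : ℝ × ℝ}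
    (hw : w ∈ chartDomain) : liftAmplitude g χ (chartPoint w) = g w := by
  have h0 : w.1 ≠ 0 := (zero_lt_one.trans (show 1 < w.1 from hw)).ne'
  have h1 : (chartBase w).1 - chartHeight w = nullHeight w := by
    unfold chartBase chartHeight; ring
  have h2 : (chartBase w).2 / w.1 = w.2 := by
    unfold chartBase; field_simp
  simp only [liftAmplitude, chartPoint]
  simp only [Matrix.cons_val_zero, Matrix.cons_val_one,
    chartBase_add_chartHeight, h1, h2]
  by_cases hgw : g w = 0
  · simp [hgw]
  · simp [hχ w (hg hgw)]

/-- A smooth cutoff, equal to `1` on `[-1, 1]` and vanishing outside `[-2, 2]`. -/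
noncomputable def plateau (x : ℝ) : ℝ :=
  Real.smoothTransition (2 - x) * Real.smoothTransition (2 + x)

lemma contDiff_plateau : ContDiff ℝ ∞ plateau :=
  (Real.smoothTransition.contDiff.comp (contDiff_const.sub contDiff_id)).mul
    (Real.smoothTransition.contDiff.comp (contDiff_const.add contDiff_id))

lemma plateau_eq_one {x : ℝ} (h : |x| ≤ 1) : plateau x = 1 := by
  obtain ⟨h1, h2⟩ := abs_le.mp h
  rw [plateau, Real.smoothTransition.one_of_one_le (by linarith),
    Real.smoothTransition.one_of_one_le (by linarith), one_mul]

lemma abs_le_of_plateau_ne_zero {x : ℝ} (h : plateau x ≠ 0) : |x| ≤ 2 := by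
  by_contra hx
  apply h
  rw [not_le, lt_abs] at hx
  rcases hx with hx | hx
  · rw [plateau, Real.smoothTransition.zero_of_nonpos (x := 2 - x) (by linarith), zero_mul]
  · rw [plateau, Real.smoothTransition.zero_of_nonpos (x := 2 + x) (by linarith), mul_zero]

lemma plateau_nonneg (x : ℝ) : 0 ≤ plateau x :=
  mul_nonneg (Real.smoothTransition.nonneg _) (Real.smoothTransition.nonneg _)

lemma plateau_le_one (x : ℝ) : plateau x ≤ 1 :=
  mul_le_one₀ (Real.smoothTransition.le_one _) (Real.smoothTransition.nonneg _)
    (Real.smoothTransition.le_one _)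

/-- The restriction to the chart of the extension inequality. -/
theorem ExtensionBound.exists_chartBound {p q : ℝ≥0∞} (h : ExtensionBound p q) :
    ∃ C : ℝ≥0∞, C ≠ ⊤ ∧ ChartBound p q C := by
  obtain ⟨C, hC⟩ := h
  obtain ⟨c, hc0, hct, hc⟩ := exists_eLpNorm_comp_eq nullCoords q
  refine ⟨c⁻¹ * C, ENNReal.mul_ne_top (ENNReal.inv_ne_top.mpr hc0) ENNReal.coe_ne_top,
    fun g hg => ?_⟩
  obtain ⟨hgs, K, hKD, hK, hgK⟩ := id hg
  have hcont : ContinuousOn nullHeight K := by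
    intro w hw
    have h0 : w.1 ≠ 0 := (zero_lt_one.trans (show 1 < w.1 from hKD hw)).ne'
    have : ContinuousAt nullHeight w := by
      unfold nullHeight
      fun_prop (disch := exact h0)
    exact this.continuousWithinAt
  obtain ⟨M, hM⟩ := hK.exists_bound_of_continuousOn hcont
  -- The cutoff must be `1` at every value of `ξ₀ - τ` attained over `K`, so that it is invisible on
  -- `Γ` while making the ambient function compactly supported.
  set b : ℝ := max M 1
  have hb : 0 < b := lt_max_of_lt_right one_pos
  let χ : ℝ → ℝ := fun x => plateau (x / b)
  have hχs : ContDiff ℝ ∞ χ := contDiff_plateau.comp (contDiff_id.div_const b)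
  have hχc : HasCompactSupport χ := by
    refine HasCompactSupport.of_support_subset_isCompact (isCompact_Icc (a := -(2 * b)) (b := 2 * b))
      fun x hx => ?_
    have := abs_le_of_plateau_ne_zero hx
    rw [abs_div, abs_of_pos hb, div_le_iff₀ hb] at this
    exact abs_le.mp this
  have hχ1 : ∀ w ∈ K, χ (nullHeight w) = 1 := fun w hw => by
    refine plateau_eq_one ?_
    rw [abs_div, abs_of_pos hb, div_le_one hb]
    exact (hM w hw).trans (le_max_left _ _)
  set f := liftAmplitude g χ with hf
  have hfs : ContDiff ℝ ∞ f := contDiff_liftAmplitude hg hχs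
  have hfc := hC f hfs (hasCompactSupport_liftAmplitude hg hχc)
  have hsub : Function.support f ⊆ chartRegion := by
    intro z hz
    obtain ⟨p, hp, rfl⟩ := support_liftAmplitude_subset hKD hgK (subset_tsupport χ) hz
    have : 1 < p.1.1 := hKD hp.1
    simp [chartRegion]
    linarith
  have hD : MeasurableSet chartDomain := isOpen_chartDomain.measurableSet
  have hfm : Measurable f := hfs.continuous.measurable
  have hnorm : eLpNorm f p hyperboloidMeasure = eLpNorm g p volume := by
    rw [← eLpNorm_restrict_eq_of_support_subset hsub, hyperboloidMeasure_restrict_chartRegion,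
      eLpNorm_map_measure hfm.aestronglyMeasurable measurable_chartPoint.aemeasurable,
      ← eLpNorm_restrict_eq_of_support_subset (hgK.trans hKD)]
    refine eLpNorm_congr_ae ?_
    filter_upwards [ae_restrict_mem hD] with w hw
    exact liftAmplitude_chartPoint hgK hχ1 hw
  have hext : extensionOp f = fun z => oscillatoryIntegral chartPhase g (nullCoords z) := by
    funext z
    have hphase : Measurable fun ζ : Spacetime =>
        Complex.exp (Complex.I * ((z.1 * ζ.1 + inner ℝ z.2 ζ.2 : ℝ) : ℂ)) * f ζ := by
      refine Measurable.mul ?_ hfm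
      fun_prop
    rw [extensionOp, oscillatoryIntegral, ← setIntegral_eq_integral_of_forall_compl_eq_zero
      (s := chartRegion), hyperboloidMeasure_restrict_chartRegion,
      integral_map measurable_chartPoint.aemeasurable hphase.aestronglyMeasurable,
      ← setIntegral_eq_integral_of_forall_compl_eq_zero (s := chartDomain) (μ := volume)]
    · refine setIntegral_congr_fun hD fun w hw => ?_
      rw [hf, liftAmplitude_chartPoint hgK hχ1 hw]
      congr 4
      simp [chartPoint, chartPhase, nullCoords_apply, chartBase, chartHeight,
        PiLp.inner_apply, Fin.sum_univ_two]
      ring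
    · intro w hw
      have : g w = 0 := by
        by_contra hne
        exact hw (hKD (hgK hne))
      simp [this]
    · intro ζ hζ
      have : f ζ = 0 := by
        by_contra hne
        exact hζ (hsub hne)
      simp [this]
  rw [hnorm, hext, hc] at hfc
  rw [mul_assoc, mul_comm c⁻¹, ← div_eq_mul_inv, ENNReal.le_div_iff_mul_le (Or.inl hc0) (Or.inl hct)]
  rwa [mul_comm]

/-! ### Scalings and limits of rescaled inequalities -/

lemma map_affine_volume {a : ℝ} (ha : a ≠ 0) (k : ℝ) :
    (volume : Measure ℝ).map (fun x => k + a * x) = ENNReal.ofReal |a⁻¹| • volume := by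
  have h : (fun x : ℝ => k + a * x) = (fun x => k + x) ∘ fun x => a * x := rfl
  rw [h, ← Measure.map_map (measurable_const_add k) (measurable_const_mul a),
    Real.map_volume_mul_left ha, Measure.map_smul, map_add_left_eq_self]

lemma map_affine_volume_prod {a b : ℝ} (ha : a ≠ 0) (hb : b ≠ 0) (k : ℝ) :
    (volume : Measure (ℝ × ℝ)).map (fun w => (k + a * w.1, b * w.2)) =
      ENNReal.ofReal |(a * b)⁻¹| • volume := by
  have h := Measure.map_prod_map (volume : Measure ℝ) (volume : Measure ℝ)
    (f := fun x => k + a * x) (g := fun x => b * x) (by fun_prop) (by fun_prop)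
  rw [map_affine_volume ha, Real.map_volume_mul_left hb, Measure.prod_smul_left,
    Measure.prod_smul_right, smul_smul, ← ENNReal.ofReal_mul (abs_nonneg _), ← abs_mul,
    ← mul_inv] at h
  exact h.symm

lemma map_scaling_volume_prod {a b c : ℝ} (ha : a ≠ 0) (hb : b ≠ 0) (hc : c ≠ 0) :
    (volume : Measure (ℝ × ℝ × ℝ)).map (fun z => (a * z.1, b * z.2.1, c * z.2.2)) =
      ENNReal.ofReal |(a * b * c)⁻¹| • volume := by
  have h1 := map_affine_volume_prod hb hc 0
  simp only [zero_add] at h1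
  have h := Measure.map_prod_map (volume : Measure ℝ) (volume : Measure (ℝ × ℝ))
    (f := fun x => a * x) (g := fun w => (b * w.1, c * w.2)) (by fun_prop) (by fun_prop)
  rw [h1, Real.map_volume_mul_left ha, Measure.prod_smul_left,
    Measure.prod_smul_right, smul_smul, ← ENNReal.ofReal_mul (abs_nonneg _), ← abs_mul,
    ← mul_inv, ← mul_assoc] at h
  exact h.symm

/-- The diagonal scaling of `ℝ³` as a homeomorphism. -/
noncomputable def scalingHomeomorph {a b c : ℝ} (ha : a ≠ 0) (hb : b ≠ 0) (hc : c ≠ 0) :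
    (ℝ × ℝ × ℝ) ≃ₜ (ℝ × ℝ × ℝ) :=
  (Homeomorph.mulLeft₀ a ha).prodCongr
    ((Homeomorph.mulLeft₀ b hb).prodCongr (Homeomorph.mulLeft₀ c hc))

/-- The map `(r, s) ↦ (k + a r, b s)` as a homeomorphism. -/
noncomputable def diagonalAffine {a b : ℝ} (ha : a ≠ 0) (hb : b ≠ 0) (k : ℝ) : (ℝ × ℝ) ≃ₜ (ℝ × ℝ) :=
  ((Homeomorph.mulLeft₀ a ha).trans (Homeomorph.addLeft k)).prodCongr (Homeomorph.mulLeft₀ b hb)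

lemma eLpNorm_comp_homeomorph {E : Type*} [TopologicalSpace E] [MeasureSpace E]
    [BorelSpace E] (A : E ≃ₜ E) {c : ℝ≥0∞} (hc : c ≠ 0) (hA : volume.map A = c • volume)
    (f : E → ℂ) (q : ℝ≥0∞) :
    eLpNorm (fun x => f (A x)) q volume = c ^ (1 / q).toReal * eLpNorm f q volume := by
  have h := A.measurableEmbedding.eLpNorm_map_measure (g := f) (p := q) (μ := volume)
  rw [hA, eLpNorm_smul_measure_of_ne_zero hc, smul_eq_mul] at h
  exact h.symm

lemma eLpNorm_comp_scaling {a b c : ℝ} (ha : a ≠ 0) (hb : b ≠ 0) (hc : c ≠ 0)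
    (f : ℝ × ℝ × ℝ → ℂ) (q : ℝ≥0∞) :
    eLpNorm (fun z : ℝ × ℝ × ℝ => f (a * z.1, b * z.2.1, c * z.2.2)) q volume =
      ENNReal.ofReal |(a * b * c)⁻¹| ^ (1 / q).toReal * eLpNorm f q volume := by
  refine eLpNorm_comp_homeomorph (scalingHomeomorph ha hb hc) ?_ (map_scaling_volume_prod ha hb hc)
    f q
  simp [ha, hb, hc]

/-- Convergence of rescaled extension inequalities. The chart is rescaled by the maps `A n` and
physical space by the maps `D n`; `e` is the resulting power of the scale `n + 1`. -/
theorem ChartBound.eLpNorm_rescaling_limit {p q C κ : ℝ≥0∞} {m k e : ℝ} (hC : ChartBound p q C)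
    (he : e = m + k * (1 / q).toReal - m * (1 / p).toReal)
    {A : ℕ → (ℝ × ℝ) ≃ₜ (ℝ × ℝ)} {D : ℕ → ℝ × ℝ × ℝ → ℝ × ℝ × ℝ} {θ : ℕ → ℝ × ℝ × ℝ → ℝ}
    {ψ : ℕ → ℝ × ℝ × ℝ → ℝ × ℝ → ℝ} {ψ' : ℝ × ℝ × ℝ → ℝ × ℝ → ℝ}
    {g : ℕ → ℝ × ℝ → ℂ} {G : ℝ × ℝ → ℂ}
    (hA : ∀ n : ℕ, volume.map (A n) = ENNReal.ofReal (((n : ℝ) + 1) ^ m) • volume)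
    (hD : ∀ (n : ℕ) (f : ℝ × ℝ × ℝ → ℂ), eLpNorm (fun z => f (D n z)) q volume ≤
      κ * ENNReal.ofReal (((n : ℝ) + 1) ^ (k * (1 / q).toReal)) * eLpNorm f q volume)
    (hphase : ∀ n z w, A n w ∈ chartDomain →
      chartPhase (D n z) (A n w) = θ n z + ψ n z w)
    (hψ : ∀ n, Measurable (Function.uncurry (ψ n)))
    (hg : ∀ n, IsChartAmplitude (g n)) (hG : Integrable G)
    (hle : ∀ n w, ‖g n (A n w)‖ ≤ ‖G w‖)
    (hlim : ∀ w, G w ≠ 0 → Tendsto (fun n => g n (A n w)) atTop (𝓝 (G w)))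
    (hψlim : ∀ z w, G w ≠ 0 → Tendsto (fun n => ψ n z w) atTop (𝓝 (ψ' z w))) :
    (e ≤ 0 → eLpNorm (oscillatoryIntegral ψ' G) q volume ≤ κ * C * eLpNorm G p volume) ∧
    (C ≠ ⊤ → κ ≠ ⊤ → eLpNorm G p volume ≠ ⊤ → (e < 0 ∨ C = 0) →
      eLpNorm (oscillatoryIntegral ψ' G) q volume = 0) := by
  have hpos : ∀ n : ℕ, (0 : ℝ) < (n : ℝ) + 1 := fun n => by positivity
  have hgm : ∀ n, Measurable fun w => g n (A n w) := fun n =>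
    (hg n).1.continuous.measurable.comp (A n).continuous.measurable
  -- The power `e` collects `l ^ m` from the change of variables in the integral, `l ^ (k/q)` from
  -- physical space, and `l ^ (-m/p)` from the norm of `g n`.
  have hbound : ∀ n : ℕ, eLpNorm (oscillatoryIntegral (ψ n) fun w => g n (A n w)) q volume ≤
      ENNReal.ofReal (((n : ℝ) + 1) ^ e) * (κ * C * eLpNorm G p volume) := by
    intro n
    set l : ℝ := (n : ℝ) + 1
    have hl : 0 < l := hpos n
    have hlm : 0 < l ^ m := Real.rpow_pos_of_pos hl m
    -- The part `θ n z` of the phase does not depend on `w`; it leaves the integral as a unimodular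
    -- factor.
    have hint : ∀ z, oscillatoryIntegral (ψ n) (fun w => g n (A n w)) z =
        Complex.exp (Complex.I * ((-θ n z : ℝ) : ℂ)) * ((l ^ m : ℝ) : ℂ) *
          oscillatoryIntegral chartPhase (g n) (D n z) := by
      intro z
      have h1 := (A n).measurableEmbedding.integral_map (μ := volume)
        (fun w => Complex.exp (Complex.I * (chartPhase (D n z) w : ℂ)) * g n w)
      rw [hA n, integral_smul_measure, ENNReal.toReal_ofReal hlm.le] at h1
      rw [mul_assoc, ← Complex.real_smul, oscillatoryIntegral, oscillatoryIntegral, h1,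
        ← integral_const_mul]
      refine integral_congr_ae (Eventually.of_forall fun w => ?_)
      simp only
      by_cases hw : g n (A n w) = 0
      · simp [hw]
      · obtain ⟨-, K, hK, -, hgK⟩ := hg n
        rw [hphase n z w (hK (hgK hw)), ← mul_assoc, ← Complex.exp_add]
        congr 2
        push_cast
        ring
    have hnorm : eLpNorm (oscillatoryIntegral (ψ n) fun w => g n (A n w)) q volume =
        ENNReal.ofReal (l ^ m) *
          eLpNorm (fun z => oscillatoryIntegral chartPhase (g n) (D n z)) q volume := by
      have h2 := eLpNorm_const_smul (l ^ m)
        (fun z => oscillatoryIntegral chartPhase (g n) (D n z)) q volume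
      rw [Real.enorm_eq_ofReal hlm.le] at h2
      rw [← h2]
      refine eLpNorm_congr_norm_ae (Eventually.of_forall fun z => ?_)
      rw [hint z, norm_mul, norm_mul, Complex.norm_exp_I_mul_ofReal, Pi.smul_apply, norm_smul,
        one_mul, Complex.norm_real]
    have h3 := eLpNorm_comp_homeomorph (A n) (ENNReal.ofReal_pos.mpr hlm).ne' (hA n) (g n) p
    rw [ENNReal.ofReal_rpow_of_pos hlm, ← Real.rpow_mul hl.le] at h3
    have h4 : eLpNorm (fun w => g n (A n w)) p volume ≤ eLpNorm G p volume :=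
      eLpNorm_mono (hle n)
    have h5 : eLpNorm (g n) p volume ≤
        ENNReal.ofReal (l ^ (-(m * (1 / p).toReal))) * eLpNorm G p volume := by
      calc eLpNorm (g n) p volume = ENNReal.ofReal (l ^ (-(m * (1 / p).toReal))) *
            (ENNReal.ofReal (l ^ (m * (1 / p).toReal)) * eLpNorm (g n) p volume) := by
            rw [← mul_assoc, ← ENNReal.ofReal_mul (by positivity), ← Real.rpow_add hl,
              neg_add_cancel, Real.rpow_zero, ENNReal.ofReal_one, one_mul]
        _ ≤ _ := by rw [← h3]; gcongr
    calc _ ≤ ENNReal.ofReal (l ^ m) * (κ * ENNReal.ofReal (l ^ (k * (1 / q).toReal)) *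
          (C * (ENNReal.ofReal (l ^ (-(m * (1 / p).toReal))) * eLpNorm G p volume))) := by
          rw [hnorm]
          gcongr
          exact (hD n _).trans (by gcongr; exact (hC _ (hg n)).trans (by gcongr))
      _ = (ENNReal.ofReal (l ^ m) * ENNReal.ofReal (l ^ (k * (1 / q).toReal)) *
          ENNReal.ofReal (l ^ (-(m * (1 / p).toReal)))) * (κ * C * eLpNorm G p volume) := by ring
      _ = _ := by
          rw [← ENNReal.ofReal_mul (by positivity), ← ENNReal.ofReal_mul (by positivity),
            ← Real.rpow_add hl, ← Real.rpow_add hl, he, sub_eq_add_neg]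
  have hmeas : ∀ n, AEStronglyMeasurable (oscillatoryIntegral (ψ n) fun w => g n (A n w)) := fun n =>
    (stronglyMeasurable_oscillatoryIntegral (hψ n) (hgm n)).aestronglyMeasurable
  have htend := tendsto_oscillatoryIntegral hψ hgm hG hle hlim hψlim
  refine ⟨fun he0 => ?_, fun hCt hκ hGp h => ?_⟩
  · refine Lp.eLpNorm_le_of_ae_tendsto (u := atTop) (Eventually.of_forall fun n => ?_) hmeas
      (Eventually.of_forall htend)
    refine (hbound n).trans ?_
    refine mul_le_of_le_one_left' ?_
    rw [ENNReal.ofReal_le_one]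
    exact Real.rpow_le_one_of_one_le_of_nonpos (by simp) he0
  · have hfin : κ * C * eLpNorm G p volume ≠ ⊤ := by finiteness
    have hlim0 : Tendsto (fun n : ℕ => ENNReal.ofReal (((n : ℝ) + 1) ^ e) *
        (κ * C * eLpNorm G p volume)) atTop (𝓝 0) := by
      rcases h with h | h
      · have h1 : Tendsto (fun n : ℕ => ((n : ℝ) + 1) ^ e) atTop (𝓝 0) := by
          have h2 := (tendsto_rpow_neg_atTop (neg_pos.mpr h)).comp
            (tendsto_atTop_add_const_right atTop (1 : ℝ) tendsto_natCast_atTop_atTop)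
          simpa [Function.comp_def] using h2
        have h3 := ENNReal.Tendsto.mul_const (ENNReal.tendsto_ofReal h1) (Or.inr hfin)
        simpa using h3
      · simp [h]
    refine le_antisymm ?_ zero_le
    have h6 := Lp.eLpNorm_lim_le_liminf_eLpNorm (p := q) hmeas _ (Eventually.of_forall htend)
    refine h6.trans ((liminf_le_liminf (Eventually.of_forall hbound)).trans ?_)
    exact hlim0.liminf_eq.le

lemma norm_plateau_mul_le (x : ℝ) (c : ℂ) : ‖(plateau x : ℂ) * c‖ ≤ ‖c‖ := by
  rw [norm_mul, Complex.norm_real, Real.norm_of_nonneg (plateau_nonneg x)]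
  exact mul_le_of_le_one_left (norm_nonneg _) (plateau_le_one x)

lemma contDiff_ofReal_plateau : ContDiff ℝ ∞ fun x : ℝ => (plateau x : ℂ) :=
  Complex.ofRealCLM.contDiff.comp contDiff_plateau

lemma eventually_plateau_div_eq_one (x : ℝ) :
    ∀ᶠ n : ℕ in atTop, plateau (x / ((n : ℝ) + 1)) = 1 := by
  filter_upwards [eventually_ge_atTop ⌈|x|⌉₊] with n hn
  have h : |x| ≤ n := Nat.ceil_le.mp hn
  have hp : (0 : ℝ) < (n : ℝ) + 1 := by positivity
  refine plateau_eq_one ?_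
  rw [abs_div, abs_of_pos hp, div_le_one hp]
  linarith

lemma tendsto_div_natCast_add_one (x : ℝ) :
    Tendsto (fun n : ℕ => x / ((n : ℝ) + 1)) atTop (𝓝 0) := by
  have h := (tendsto_one_div_add_atTop_nhds_zero_nat (𝕜 := ℝ)).const_mul x
  simpa [div_eq_mul_inv] using h

/-! ### The saddle and the cone as limits of the hyperboloid -/

/-- The phase of the extension operator of the saddle `τ = r² - s²`. -/
def saddlePhase (z : ℝ × ℝ × ℝ) (w : ℝ × ℝ) : ℝ :=
  z.2.2 * w.1 + z.2.1 * w.2 + z.1 * (w.1 ^ 2 - w.2 ^ 2)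

/-- The phase of the extension operator of the cone. -/
def conePhase (z : ℝ × ℝ × ℝ) (w : ℝ × ℝ) : ℝ :=
  w.1 * (z.2.2 + z.2.1 * w.2 - z.1 * w.2 ^ 2)

/-- The linear map combined with the parabolic scaling on the physical side. -/
noncomputable def saddleShear : (ℝ × ℝ × ℝ) ≃L[ℝ] (ℝ × ℝ × ℝ) :=
  LinearEquiv.toContinuousLinearEquiv
    { toFun := fun z => (2 * z.1, z.2.1, (z.2.2 + z.1) / 2)
      invFun := fun z => (z.1 / 2, z.2.1, 2 * z.2.2 - z.1 / 2)
      map_add' := fun z z' => by ext <;> simp <;> ring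
      map_smul' := fun c z => by ext <;> simp <;> ring
      left_inv := fun z => by
        refine Prod.ext (by simp) (Prod.ext rfl ?_)
        simp only
        ring
      right_inv := fun z => by ext <;> simp <;> ring }

lemma saddleShear_apply (z : ℝ × ℝ × ℝ) :
    saddleShear z = (2 * z.1, z.2.1, (z.2.2 + z.1) / 2) := rfl

lemma diagonalAffine_apply {a b : ℝ} (ha : a ≠ 0) (hb : b ≠ 0) (k : ℝ) (w : ℝ × ℝ) :
    diagonalAffine ha hb k w = (k + a * w.1, b * w.2) := rfl

/-- Parabolic rescaling of the hyperboloid at a point converges to the saddle. -/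
theorem ChartBound.eLpNorm_saddle_limit {p q C : ℝ≥0∞} (hC : ChartBound p q C) {e : ℝ}
    (he : e = 2 - 4 * (1 / q).toReal - 2 * (1 / p).toReal) {G : ℝ × ℝ → ℂ}
    (hG : ContDiff ℝ ∞ G) (hGi : Integrable G) :
    ∃ κ : ℝ≥0∞, κ ≠ ⊤ ∧
      (e ≤ 0 → eLpNorm (oscillatoryIntegral saddlePhase G) q volume ≤ κ * C * eLpNorm G p volume) ∧
      (C ≠ ⊤ → eLpNorm G p volume ≠ ⊤ → (e < 0 ∨ C = 0) →
        eLpNorm (oscillatoryIntegral saddlePhase G) q volume = 0) := by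
  obtain ⟨κ, -, hκ, hκf⟩ := exists_eLpNorm_comp_eq saddleShear q
  have hl : ∀ n : ℕ, (0 : ℝ) < (n : ℝ) + 1 := fun n => by positivity
  have ha : ∀ n : ℕ, 2 / ((n : ℝ) + 1) ≠ 0 := fun n => by have := hl n; positivity
  have hb : ∀ n : ℕ, 1 / (2 * ((n : ℝ) + 1)) ≠ 0 := fun n => by have := hl n; positivity
  let A : ℕ → (ℝ × ℝ) ≃ₜ (ℝ × ℝ) := fun n => diagonalAffine (ha n) (hb n) 2
  have hAapp : ∀ n w, A n w =
      (2 + 2 / ((n : ℝ) + 1) * w.1, 1 / (2 * ((n : ℝ) + 1)) * w.2) := fun n w => rfl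
  -- The factor `6` confines `w.1` to `|w.1| ≤ (n + 1) / 3`, so that `ρ = 2 + 2 w.1 / (n + 1) ≥ 4/3`
  -- stays in the chart.
  let H : ℕ → ℝ × ℝ → ℂ := fun n w => (plateau (6 * w.1 / ((n : ℝ) + 1)) : ℂ) *
    ((plateau (6 * w.2 / ((n : ℝ) + 1)) : ℂ) * G w)
  have hHs : ∀ n, ContDiff ℝ ∞ (H n) := fun n =>
    (contDiff_ofReal_plateau.comp ((contDiff_const.mul contDiff_fst).div_const _)).mul
      ((contDiff_ofReal_plateau.comp ((contDiff_const.mul contDiff_snd).div_const _)).mul hG)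
  -- The zoom is at `(ρ, s) = (2, 0)`. The shear in `D` cancels the linear term of `1/ρ` there,
  -- which would otherwise grow like `n + 1`; constant terms go into `θ`.
  have h := hC.eLpNorm_rescaling_limit (m := 2) (k := -4) (κ := κ) (e := e) (A := A)
    (D := fun n z => saddleShear (((n : ℝ) + 1) ^ 2 * z.1, ((n : ℝ) + 1) * z.2.1,
      ((n : ℝ) + 1) * z.2.2))
    (θ := fun n z => 2 * ((((n : ℝ) + 1) * z.2.2 + ((n : ℝ) + 1) ^ 2 * z.1) / 2) +
      ((n : ℝ) + 1) ^ 2 * z.1)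
    (ψ := fun n z w => z.2.2 * w.1 + z.2.1 * w.2 * (1 + w.1 / ((n : ℝ) + 1)) +
      z.1 * (w.1 ^ 2 / (1 + w.1 / ((n : ℝ) + 1)) - w.2 ^ 2 * (1 + w.1 / ((n : ℝ) + 1))))
    (ψ' := saddlePhase) (g := fun n w => H n ((A n).symm w)) (G := G)
    (by rw [he]; ring) ?_ ?_ ?_ ?_ ?_ hGi ?_ ?_ ?_
  · exact ⟨κ, hκ, h.1, fun h1 => h.2 h1 hκ⟩
  · intro n
    have := map_affine_volume_prod (ha n) (hb n) 2
    have h2 : |(2 / ((n : ℝ) + 1) * (1 / (2 * ((n : ℝ) + 1))))⁻¹| = ((n : ℝ) + 1) ^ (2 : ℝ) := by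
      have := hl n
      rw [abs_of_pos (by positivity), Real.rpow_two]
      field_simp
    rw [h2] at this
    exact this
  · intro n f
    have h1 := eLpNorm_comp_scaling (pow_pos (hl n) 2).ne' (hl n).ne' (hl n).ne'
      (fun z => f (saddleShear z)) q
    have h2 : |(((n : ℝ) + 1) ^ 2 * ((n : ℝ) + 1) * ((n : ℝ) + 1))⁻¹| = ((n : ℝ) + 1) ^ (-4 : ℝ) := by
      have := hl n
      rw [abs_of_pos (by positivity), Real.rpow_neg this.le]
      congr 1
      norm_cast
    rw [h2, hκf, ENNReal.ofReal_rpow_of_pos (Real.rpow_pos_of_pos (hl n) _),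
      ← Real.rpow_mul (hl n).le] at h1
    rw [h1]
    exact le_of_eq (by ring)
  · intro n z w hw
    have h1 : 1 < 2 + 2 / ((n : ℝ) + 1) * w.1 := hw
    have hl := hl n
    have h2 : (1 : ℝ) + w.1 / ((n : ℝ) + 1) ≠ 0 := by
      intro h0
      have : 2 + 2 / ((n : ℝ) + 1) * w.1 = 2 * (1 + w.1 / ((n : ℝ) + 1)) := by ring
      rw [this, h0] at h1
      norm_num at h1
    have h3 : (n : ℝ) + 1 + w.1 ≠ 0 := by
      intro h0
      apply h2
      field_simp
      linarith
    have h4 : 2 + 2 / ((n : ℝ) + 1) * w.1 = 2 * (1 + w.1 / ((n : ℝ) + 1)) := by ring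
    -- Taylor expansion to first order with exact remainder; the remainder, multiplied by `(n +
    -- 1)²`, tends to the quadratic term of the saddle.
    have h5 : 1 / (1 + w.1 / ((n : ℝ) + 1)) = 1 - w.1 / ((n : ℝ) + 1) +
        1 / ((n : ℝ) + 1) ^ 2 * (w.1 ^ 2 / (1 + w.1 / ((n : ℝ) + 1))) := by
      field_simp
      ring
    simp only [hAapp, chartPhase, nullHeight, saddleShear_apply]
    rw [h4, one_div (2 * (1 + _)), mul_inv, ← one_div (1 + _), h5]
    field_simp
    ring
  · intro n
    unfold Function.uncurry
    fun_prop
  · intro n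
    refine ⟨(hHs n).comp ?_, A n '' (Icc (-(((n : ℝ) + 1) / 3)) (((n : ℝ) + 1) / 3) ×ˢ
      Icc (-(((n : ℝ) + 1) / 3)) (((n : ℝ) + 1) / 3)), ?_,
      (isCompact_Icc.prod isCompact_Icc).image (A n).continuous, ?_⟩
    · have : ⇑(A n).symm = fun w : ℝ × ℝ =>
        ((2 / ((n : ℝ) + 1))⁻¹ * (-2 + w.1), (1 / (2 * ((n : ℝ) + 1)))⁻¹ * w.2) := rfl
      rw [this]
      fun_prop
    · rintro _ ⟨w, ⟨⟨hw, -⟩, -⟩, rfl⟩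
      change 1 < 2 + 2 / ((n : ℝ) + 1) * w.1
      have := hl n
      have h1 : 2 / ((n : ℝ) + 1) * (-(((n : ℝ) + 1) / 3)) ≤ 2 / ((n : ℝ) + 1) * w.1 :=
        mul_le_mul_of_nonneg_left hw (by positivity)
      have h2 : 2 / ((n : ℝ) + 1) * (-(((n : ℝ) + 1) / 3)) = -(2 / 3) := by field_simp
      linarith
    · intro w hw
      refine ⟨(A n).symm w, ?_, (A n).apply_symm_apply w⟩
      have key : ∀ x : ℝ, plateau (6 * x / ((n : ℝ) + 1)) ≠ 0 →
          x ∈ Icc (-(((n : ℝ) + 1) / 3)) (((n : ℝ) + 1) / 3) := by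
        intro x hx
        have h1 := abs_le_of_plateau_ne_zero hx
        have := hl n
        rw [abs_div, abs_of_pos this, div_le_iff₀ this, abs_mul, abs_of_pos (by norm_num : (0:ℝ) < 6)]
          at h1
        exact abs_le.mp (by linarith)
      constructor
      · refine key _ fun h0 => hw ?_
        simp [H, h0]
      · refine key _ fun h0 => hw ?_
        simp [H, h0]
  · intro n w
    simp only [Homeomorph.symm_apply_apply]
    exact (norm_plateau_mul_le _ _).trans (norm_plateau_mul_le _ _)
  · intro w _
    simp only [Homeomorph.symm_apply_apply]
    refine tendsto_const_nhds.congr' ?_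
    filter_upwards [eventually_plateau_div_eq_one (6 * w.1),
      eventually_plateau_div_eq_one (6 * w.2)] with n h1 h2
    simp [H, h1, h2]
  · intro z w _
    have h0 : Tendsto (fun n : ℕ => 1 + w.1 / ((n : ℝ) + 1)) atTop (𝓝 1) := by
      simpa using (tendsto_div_natCast_add_one w.1).const_add 1
    have h1 := ((h0.const_mul (z.2.1 * w.2)).const_add (z.2.2 * w.1)).add
      ((((tendsto_const_nhds (x := w.1 ^ 2)).div h0 one_ne_zero).sub
        (h0.const_mul (w.2 ^ 2))).const_mul z.1)
    simpa [saddlePhase] using h1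

/-- The isotropic rescaling of the hyperboloid converges to the cone. -/
theorem ChartBound.eLpNorm_cone_limit {p q C : ℝ≥0∞} (hC : ChartBound p q C) {e : ℝ}
    (he : e = 3 * (1 / q).toReal + (1 / p).toReal - 1) {G : ℝ × ℝ → ℂ}
    (hG : ∀ w : ℝ × ℝ, 0 < w.1 → ContDiffAt ℝ ∞ G w) (hG0 : ∀ w : ℝ × ℝ, w.1 ≤ 0 → G w = 0)
    (hGi : Integrable G) :
    (e ≤ 0 → eLpNorm (oscillatoryIntegral conePhase G) q volume ≤ C * eLpNorm G p volume) ∧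
      (C ≠ ⊤ → eLpNorm G p volume ≠ ⊤ → e < 0 →
        eLpNorm (oscillatoryIntegral conePhase G) q volume = 0) := by
  have hl : ∀ n : ℕ, (0 : ℝ) < (n : ℝ) + 1 := fun n => by positivity
  let A : ℕ → (ℝ × ℝ) ≃ₜ (ℝ × ℝ) := fun n => diagonalAffine (hl n).ne' one_ne_zero 0
  have hAapp : ∀ n w, A n w = (((n : ℝ) + 1) * w.1, w.2) := fun n w => by
    simp [A, diagonalAffine_apply]
  -- The first cutoff keeps the support in `ρ ≥ 2`, away from the possible singularity of `G` at `r
  -- = 0`; the plateaus make it compact. In the variable `r = ρ / (n + 1)` all three become `1` at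
  -- each fixed point with `r > 0`.
  let g : ℕ → ℝ × ℝ → ℂ := fun n w => ((Real.smoothTransition (w.1 - 2) : ℝ) : ℂ) *
    ((plateau (w.1 / ((n : ℝ) + 1) / ((n : ℝ) + 1)) : ℂ) * ((plateau (w.2 / ((n : ℝ) + 1)) : ℂ) *
      G (w.1 / ((n : ℝ) + 1), w.2)))
  have h := hC.eLpNorm_rescaling_limit (m := -1) (k := 3) (κ := 1) (e := e) (A := A)
    (D := fun n z => (((n : ℝ) + 1)⁻¹ * z.1, ((n : ℝ) + 1)⁻¹ * z.2.1, ((n : ℝ) + 1)⁻¹ * z.2.2))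
    (θ := fun n z => 0)
    (ψ := fun n z w => conePhase z w + z.1 / w.1 / ((n : ℝ) + 1) / ((n : ℝ) + 1))
    (ψ' := conePhase) (g := g) (G := G)
    (by rw [he]; ring) ?_ ?_ ?_ ?_ ?_ hGi ?_ ?_ ?_
  · rw [one_mul] at h
    exact ⟨h.1, fun h1 h2 h3 => h.2 h1 ENNReal.one_ne_top h2 (Or.inl h3)⟩
  · intro n
    have := map_affine_volume_prod (hl n).ne' one_ne_zero 0
    have h2 : |(((n : ℝ) + 1) * 1)⁻¹| = ((n : ℝ) + 1) ^ (-1 : ℝ) := by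
      have := hl n
      rw [mul_one, abs_of_pos (by positivity), Real.rpow_neg_one]
    rw [h2] at this
    exact this
  · intro n f
    have h0 := (inv_pos.mpr (hl n)).ne'
    have h1 := eLpNorm_comp_scaling h0 h0 h0 f q
    have h2 : |(((n : ℝ) + 1)⁻¹ * ((n : ℝ) + 1)⁻¹ * ((n : ℝ) + 1)⁻¹)⁻¹| =
        ((n : ℝ) + 1) ^ (3 : ℝ) := by
      have := hl n
      rw [abs_of_pos (by positivity)]
      norm_cast
      simp
      ring
    rw [h2, ENNReal.ofReal_rpow_of_pos (Real.rpow_pos_of_pos (hl n) _),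
      ← Real.rpow_mul (hl n).le] at h1
    rw [h1, one_mul]
  · intro n z w hw
    rw [hAapp] at hw
    have hl := hl n
    have h1 : 1 < ((n : ℝ) + 1) * w.1 := hw
    have h2 : w.1 ≠ 0 := by
      rintro h0
      rw [h0, mul_zero] at h1
      linarith
    simp only [hAapp, chartPhase, nullHeight, conePhase]
    field_simp
    ring
  · intro n
    unfold Function.uncurry conePhase
    fun_prop
  · intro n
    have hl := hl n
    refine ⟨?_, Icc 2 (2 * ((n : ℝ) + 1) ^ 2) ×ˢ Icc (-(2 * ((n : ℝ) + 1))) (2 * ((n : ℝ) + 1)), ?_,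
      isCompact_Icc.prod isCompact_Icc, ?_⟩
    · rw [contDiff_iff_contDiffAt]
      intro w
      by_cases hw : 1 < w.1
      · have c1 : ContDiff ℝ ∞ fun w : ℝ × ℝ => ((Real.smoothTransition (w.1 - 2) : ℝ) : ℂ) :=
          Complex.ofRealCLM.contDiff.comp
            (Real.smoothTransition.contDiff.comp (contDiff_fst.sub contDiff_const))
        have c2 : ContDiff ℝ ∞ fun w : ℝ × ℝ =>
            (plateau (w.1 / ((n : ℝ) + 1) / ((n : ℝ) + 1)) : ℂ) :=
          contDiff_ofReal_plateau.comp ((contDiff_fst.div_const _).div_const _)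
        have c3 : ContDiff ℝ ∞ fun w : ℝ × ℝ => (plateau (w.2 / ((n : ℝ) + 1)) : ℂ) :=
          contDiff_ofReal_plateau.comp (contDiff_snd.div_const _)
        have c4 : ContDiff ℝ ∞ fun w : ℝ × ℝ => (w.1 / ((n : ℝ) + 1), w.2) :=
          (contDiff_fst.div_const _).prodMk contDiff_snd
        have c5 : ContDiffAt ℝ ∞ (fun w : ℝ × ℝ => G (w.1 / ((n : ℝ) + 1), w.2)) w :=
          (hG (w.1 / ((n : ℝ) + 1), w.2) (div_pos (by linarith) hl)).comp w c4.contDiffAt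
        exact c1.contDiffAt.mul (c2.contDiffAt.mul (c3.contDiffAt.mul c5))
      · have : g n =ᶠ[𝓝 w] fun _ => 0 := by
          have ho : IsOpen {w : ℝ × ℝ | w.1 < 2} := isOpen_lt continuous_fst continuous_const
          filter_upwards [ho.mem_nhds (show w.1 < 2 by linarith)] with y hy
          have hy' : y.1 < 2 := hy
          simp [g, Real.smoothTransition.zero_of_nonpos (x := y.1 - 2) (by linarith)]
        exact contDiffAt_const.congr_of_eventuallyEq this
    · rintro w ⟨⟨hw, -⟩, -⟩
      exact lt_of_lt_of_le one_lt_two hw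
    · intro w hw
      have k1 : 2 ≤ w.1 := by
        by_contra h0
        apply hw
        simp [g, Real.smoothTransition.zero_of_nonpos (x := w.1 - 2) (by linarith)]
      have k2 : plateau (w.1 / ((n : ℝ) + 1) / ((n : ℝ) + 1)) ≠ 0 := by
        intro h0
        apply hw
        simp [g, h0]
      have k3 : plateau (w.2 / ((n : ℝ) + 1)) ≠ 0 := by
        intro h0
        apply hw
        simp [g, h0]
      have j2 := abs_le_of_plateau_ne_zero k2
      have j3 := abs_le_of_plateau_ne_zero k3
      rw [abs_div, abs_of_pos hl, div_le_iff₀ hl] at j3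
      refine ⟨⟨k1, ?_⟩, abs_le.mp j3⟩
      have := (le_abs_self _).trans j2
      rw [div_div, div_le_iff₀ (by positivity)] at this
      linarith
  · intro n w
    rw [hAapp]
    have h1 : ((n : ℝ) + 1) * w.1 / ((n : ℝ) + 1) = w.1 := by
      have := hl n
      field_simp
    simp only [g, h1]
    rw [norm_mul, Complex.norm_real, Real.norm_of_nonneg (Real.smoothTransition.nonneg _)]
    refine (mul_le_of_le_one_left (norm_nonneg _) (Real.smoothTransition.le_one _)).trans ?_
    exact (norm_plateau_mul_le _ _).trans (norm_plateau_mul_le _ _)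
  · intro w hw
    have hw0 : 0 < w.1 := by
      by_contra h0
      exact hw (hG0 w (not_lt.mp h0))
    refine tendsto_const_nhds.congr' ?_
    filter_upwards [eventually_plateau_div_eq_one w.1, eventually_plateau_div_eq_one w.2,
      -- Ensures `(n + 1) r - 2 ≥ 1`, where the transition function equals `1`.
      eventually_ge_atTop ⌈3 / w.1⌉₊] with n h1 h2 h3
    have h4 : 3 / w.1 ≤ n := Nat.ceil_le.mp h3
    rw [div_le_iff₀ hw0] at h4
    have h5 : ((n : ℝ) + 1) * w.1 / ((n : ℝ) + 1) = w.1 := by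
      have := hl n
      field_simp
    rw [hAapp]
    simp only [g, h5, h1, h2]
    rw [Real.smoothTransition.one_of_one_le (by nlinarith)]
    simp
  · intro z w _
    have h1 := (tendsto_div_natCast_add_one (z.1 / w.1)).mul
      (tendsto_div_natCast_add_one 1)
    have h2 := h1.const_add (conePhase z w)
    simp only [mul_zero, add_zero] at h2
    refine h2.congr fun n => ?_
    rw [mul_one_div]

/-! ### Explicit Gaussian extension on the saddle -/

/-- A function that is `≳ 1 / (V² w(V))` on the sets `|X| ≤ V`, `|U - h(V, X)| ≤ w(V)` of the slices
`V > 1` has infinite integral. -/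
lemma lintegral_eq_top_of_slices {F : ℝ × ℝ × ℝ → ℝ≥0∞} (hF : Measurable F) {c : ℝ} (hc : 0 < c)
    {l : ℝ → ℝ} {h : ℝ → ℝ → ℝ} (hl : ∀ V > 1, 0 < l V)
    (hbd : ∀ V > 1, ∀ X U : ℝ, |X| ≤ V → |U - h V X| ≤ l V →
      ENNReal.ofReal (c / (V ^ 2 * l V)) ≤ F (V, X, U)) :
    ∫⁻ z, F z = ⊤ := by
  -- The slice contains a set of area `2V · 2 l(V)` on which `F ≥ c / (V² l(V))`; the resulting `4c
  -- / V` has divergent integral.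
  have hslice : ∀ V > 1, ENNReal.ofReal (4 * c * V⁻¹) ≤ ∫⁻ y, F (V, y) := by
    intro V hV
    have hlV := hl V hV
    have hV0 : 0 < V := by linarith
    have hm : Measurable fun y => F (V, y) := hF.comp measurable_prodMk_left
    have hinner : ∀ X ∈ Icc (-V) V, ENNReal.ofReal (2 * c / V ^ 2) ≤ ∫⁻ U, F (V, X, U) := by
      intro X hX
      calc ENNReal.ofReal (2 * c / V ^ 2)
          = ∫⁻ _ in Icc (h V X - l V) (h V X + l V), ENNReal.ofReal (c / (V ^ 2 * l V)) := by
            rw [setLIntegral_const, Real.volume_Icc, ← ENNReal.ofReal_mul (by positivity)]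
            congr 1
            field_simp
            ring
        _ ≤ ∫⁻ U in Icc (h V X - l V) (h V X + l V), F (V, X, U) := by
            refine setLIntegral_mono' measurableSet_Icc fun U hU => ?_
            refine hbd V hV X U (abs_le.mpr hX) (abs_le.mpr ⟨?_, ?_⟩)
            · linarith [hU.1]
            · linarith [hU.2]
        _ ≤ _ := setLIntegral_le_lintegral _ _
    calc ENNReal.ofReal (4 * c * V⁻¹)
        = ∫⁻ _ in Icc (-V) V, ENNReal.ofReal (2 * c / V ^ 2) := by
          rw [setLIntegral_const, Real.volume_Icc, ← ENNReal.ofReal_mul (by positivity)]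
          congr 1
          field_simp
          ring
      _ ≤ ∫⁻ X in Icc (-V) V, ∫⁻ U, F (V, X, U) := setLIntegral_mono' measurableSet_Icc hinner
      _ ≤ ∫⁻ X, ∫⁻ U, F (V, X, U) := setLIntegral_le_lintegral _ _
      _ = ∫⁻ y, F (V, y) := (lintegral_prod (fun y => F (V, y)) hm.aemeasurable).symm
  have h1 : ∫⁻ V in Ioi (1 : ℝ), ENNReal.ofReal (4 * c * V⁻¹) = ⊤ := by
    by_contra hne
    refine not_integrableOn_Ioi_inv (a := 1) ?_
    have h2 : IntegrableOn (fun V : ℝ => 4 * c * V⁻¹) (Ioi 1) := by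
      refine ⟨by fun_prop, ?_⟩
      rw [hasFiniteIntegral_iff_ofReal]
      · exact lt_top_iff_ne_top.mpr hne
      · filter_upwards [ae_restrict_mem measurableSet_Ioi] with V hV
        have : (0 : ℝ) < V := one_pos.trans hV
        positivity
    have h3 := h2.const_mul (4 * c)⁻¹
    exact IntegrableOn.congr_fun h3 (fun V _ => by field_simp) measurableSet_Ioi
  rw [eq_top_iff, ← h1]
  calc _ ≤ ∫⁻ V in Ioi (1 : ℝ), ∫⁻ y, F (V, y) := setLIntegral_mono' measurableSet_Ioi hslice
    _ ≤ ∫⁻ V, ∫⁻ y, F (V, y) := setLIntegral_le_lintegral _ _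
    _ = _ := (lintegral_prod F hF.aemeasurable).symm

lemma norm_cpow_half (x : ℂ) : ‖x ^ (1 / 2 : ℂ)‖ = √‖x‖ := by
  have h : (x ^ (1 / 2 : ℂ)) ^ 2 = x := by
    simp
  conv_rhs => rw [← h, norm_pow, Real.sqrt_sq (norm_nonneg _)]

/-- A positive factor does not change the argument, so the principal square root is multiplicative
here. -/
lemma ofReal_mul_cpow_half {r : ℝ} (hr : 0 < r) {x : ℂ} (hx : x ≠ 0) :
    ((r : ℂ) * x) ^ (1 / 2 : ℂ) = ((√r : ℝ) : ℂ) * x ^ (1 / 2 : ℂ) := by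
  rw [Complex.cpow_def_of_ne_zero (mul_ne_zero (by exact_mod_cast hr.ne') hx),
    Complex.cpow_def_of_ne_zero hx, Complex.log_ofReal_mul hr hx, add_mul, Complex.exp_add]
  congr 1
  rw [Real.sqrt_eq_rpow, Real.rpow_def_of_pos hr]
  push_cast
  rfl

lemma norm_one_add_mul_I (V : ℝ) : ‖(1 : ℂ) + V * Complex.I‖ = √(1 + V ^ 2) := by
  have := Complex.norm_add_mul_I 1 V
  simpa using this

/-- The Gaussian amplitude on the saddle. -/
noncomputable def saddleGaussian (w : ℝ × ℝ) : ℂ :=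
  (Real.exp (-1 * w.1 ^ 2) * Real.exp (-1 * w.2 ^ 2) : ℝ)

lemma contDiff_saddleGaussian : ContDiff ℝ ∞ saddleGaussian := by
  refine Complex.ofRealCLM.contDiff.comp (f := fun w : ℝ × ℝ =>
    Real.exp (-1 * w.1 ^ 2) * Real.exp (-1 * w.2 ^ 2)) ?_
  fun_prop

lemma memLp_saddleGaussian {p : ℝ≥0∞} (hp : p ≠ 0) : MemLp saddleGaussian p volume := by
  have hm := contDiff_saddleGaussian.continuous.aestronglyMeasurable (μ := (volume : Measure (ℝ × ℝ)))
  have hn : ∀ w, ‖saddleGaussian w‖ = Real.exp (-1 * w.1 ^ 2) * Real.exp (-1 * w.2 ^ 2) := fun w => by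
    rw [saddleGaussian, Complex.norm_real, Real.norm_of_nonneg (by positivity)]
  by_cases hpt : p = ⊤
  · subst hpt
    refine memLp_top_of_bound hm 1 (Eventually.of_forall fun w => ?_)
    rw [hn, ← Real.exp_add, Real.exp_le_one_iff]
    nlinarith [sq_nonneg w.1, sq_nonneg w.2]
  · rw [← integrable_norm_rpow_iff hm hp hpt]
    have hp0 := ENNReal.toReal_pos hp hpt
    have := (integrable_exp_neg_mul_sq hp0).mul_prod (integrable_exp_neg_mul_sq hp0)
    refine this.congr (Eventually.of_forall fun w => ?_)
    simp only
    rw [hn, Real.mul_rpow (Real.exp_pos _).le (Real.exp_pos _).le, ← Real.exp_mul, ← Real.exp_mul]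
    congr 2 <;> ring

lemma norm_gaussian_integral (V X : ℝ) :
    ‖∫ s : ℝ, Complex.exp (Complex.I * X * s) * Complex.exp (-(1 + V * Complex.I) * s ^ 2)‖ =
      √(Real.pi / √(1 + V ^ 2)) * Real.exp (-X ^ 2 / (4 * (1 + V ^ 2))) := by
  have hb : 0 < (1 + (V : ℂ) * Complex.I).re := by simp
  rw [fourierIntegral_gaussian hb, norm_mul, norm_cpow_half, norm_div, norm_one_add_mul_I,
    Complex.norm_real, Real.norm_of_nonneg Real.pi_pos.le, Complex.norm_exp]
  congr 2
  have h0 : (1 : ℝ) + V ^ 2 ≠ 0 := by positivity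
  have hne : (1 + (V : ℂ) * Complex.I) ≠ 0 := fun h => by rw [h] at hb; simp at hb
  have : -(X : ℂ) ^ 2 / (4 * (1 + V * Complex.I)) =
      ((-X ^ 2 / (4 * (1 + V ^ 2)) : ℝ) : ℂ) * (1 - V * Complex.I) := by
    have h0' : (1 : ℂ) + (V : ℂ) ^ 2 ≠ 0 := by exact_mod_cast h0
    push_cast
    field_simp
    ring_nf
    simp
    ring
  rw [this, Complex.re_ofReal_mul]
  simp

/-- The phase separates, leaving two one-dimensional Gaussians with parameters `1 - iV` and `1 +
iV`, whose moduli depend only on `V²`. -/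
lemma norm_saddle_extension (z : ℝ × ℝ × ℝ) :
    ‖oscillatoryIntegral saddlePhase saddleGaussian z‖ = Real.pi / √(1 + z.1 ^ 2) *
      Real.exp (-(z.2.2 ^ 2 + z.2.1 ^ 2) / (4 * (1 + z.1 ^ 2))) := by
  have h : oscillatoryIntegral saddlePhase saddleGaussian z =
      (∫ r : ℝ, Complex.exp (Complex.I * z.2.2 * r) *
        Complex.exp (-(1 + (-z.1 : ℝ) * Complex.I) * r ^ 2)) *
      ∫ s : ℝ, Complex.exp (Complex.I * z.2.1 * s) *
        Complex.exp (-(1 + z.1 * Complex.I) * s ^ 2) := by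
    rw [← integral_prod_mul]
    refine integral_congr_ae (Eventually.of_forall fun w => ?_)
    simp only [saddleGaussian, saddlePhase]
    push_cast
    rw [← Complex.exp_add, ← Complex.exp_add, ← Complex.exp_add, ← Complex.exp_add,
      ← Complex.exp_add]
    congr 1
    ring
  have hs : 0 ≤ Real.pi / √(1 + z.1 ^ 2) := by positivity
  rw [h, norm_mul, norm_gaussian_integral, norm_gaussian_integral, neg_sq, mul_mul_mul_comm,
    Real.mul_self_sqrt hs, ← Real.exp_add]
  congr 2
  ring

lemma measurable_saddlePhase : Measurable (Function.uncurry saddlePhase) := by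
  unfold Function.uncurry saddlePhase; fun_prop

lemma measurable_conePhase : Measurable (Function.uncurry conePhase) := by
  unfold Function.uncurry conePhase; fun_prop

lemma eLpNorm_ne_zero_of_forall_ne_zero {f : ℝ × ℝ × ℝ → ℂ} (hf : StronglyMeasurable f)
    (h : ∀ z, f z ≠ 0) {q : ℝ≥0∞} (hq : q ≠ 0) : eLpNorm f q volume ≠ 0 := by
  rw [Ne, eLpNorm_eq_zero_iff hf.aestronglyMeasurable hq]
  intro h0
  have : ∀ᵐ z : ℝ × ℝ × ℝ, False := h0.mono fun z hz => h z hz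
  rw [eventually_false_iff_eq_bot, ae_eq_bot] at this
  have h1 : (volume : Measure (ℝ × ℝ × ℝ)) univ ≠ 0 :=
    (isOpen_univ.measure_pos volume univ_nonempty).ne'
  rw [this] at h1
  simp at h1

lemma eLpNorm_saddle_extension_ne_zero {q : ℝ≥0∞} (hq : q ≠ 0) :
    eLpNorm (oscillatoryIntegral saddlePhase saddleGaussian) q volume ≠ 0 := by
  refine eLpNorm_ne_zero_of_forall_ne_zero (stronglyMeasurable_oscillatoryIntegral
    measurable_saddlePhase contDiff_saddleGaussian.continuous.measurable) (fun z h0 => ?_) hq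
  have h := norm_saddle_extension z
  rw [h0, norm_zero] at h
  have : 0 < Real.pi / √(1 + z.1 ^ 2) *
      Real.exp (-(z.2.2 ^ 2 + z.2.1 ^ 2) / (4 * (1 + z.1 ^ 2))) := by positivity
  linarith

lemma eLpNorm_natCast_eq_top {f : ℝ × ℝ × ℝ → ℂ} {q : ℕ} (hq : q ≠ 0)
    (h : ∫⁻ z, ENNReal.ofReal (‖f z‖ ^ q) = ⊤) : eLpNorm f q volume = ⊤ := by
  rw [eLpNorm_eq_lintegral_rpow_enorm_toReal (by exact_mod_cast hq) (ENNReal.natCast_ne_top q)]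
  have h1 : ∫⁻ z, ‖f z‖ₑ ^ (q : ℝ≥0∞).toReal = ⊤ := by
    rw [← h]
    refine lintegral_congr fun z => ?_
    rw [ENNReal.toReal_natCast, ENNReal.rpow_natCast, ENNReal.ofReal_pow (norm_nonneg _),
      ofReal_norm]
  rw [h1, ENNReal.top_rpow_of_pos]
  rw [ENNReal.toReal_natCast]
  positivity

/-- The extension is `≳ 1/V` on the box `|X|, |U| ≤ V`, so the cube integrates over each slice to `≳
V² / V³ = 1/V`. -/
lemma eLpNorm_saddle_extension_eq_top :
    eLpNorm (oscillatoryIntegral saddlePhase saddleGaussian) 3 volume = ⊤ := by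
  refine eLpNorm_natCast_eq_top (q := 3) (by norm_num) ?_
  have hm := (stronglyMeasurable_oscillatoryIntegral
    measurable_saddlePhase contDiff_saddleGaussian.continuous.measurable).measurable
  refine lintegral_eq_top_of_slices (by fun_prop) (c := (Real.pi / √2 * Real.exp (-1)) ^ 3)
    (by positivity) (l := fun V => V) (h := fun _ _ => 0) (fun V hV => by linarith) ?_
  intro V hV X U hX hU
  refine ENNReal.ofReal_le_ofReal ?_
  have hV0 : 0 < V := by linarith
  have h1 : (Real.pi / √2 * Real.exp (-1)) ^ 3 / (V ^ 2 * V) =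
      (Real.pi / (√2 * V) * Real.exp (-1)) ^ 3 := by
    field_simp
  rw [h1, norm_saddle_extension]
  rw [sub_zero] at hU
  have hX2 : X ^ 2 ≤ V ^ 2 := sq_le_sq' (abs_le.mp hX).1 (abs_le.mp hX).2
  have hU2 : U ^ 2 ≤ V ^ 2 := sq_le_sq' (abs_le.mp hU).1 (abs_le.mp hU).2
  have h2 : √(1 + V ^ 2) ≤ √2 * V := by
    rw [← Real.sqrt_sq hV0.le, ← Real.sqrt_mul zero_le_two, Real.sqrt_sq hV0.le]
    exact Real.sqrt_le_sqrt (by nlinarith)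
  have h3 : (-1 : ℝ) ≤ -(U ^ 2 + X ^ 2) / (4 * (1 + V ^ 2)) := by
    rw [le_div_iff₀ (by positivity)]
    nlinarith
  gcongr

/-! ### Explicit extension on the cone -/

/-- The amplitude on the cone whose extension is computed explicitly. -/
noncomputable def coneGaussian (w : ℝ × ℝ) : ℂ :=
  (√w.1 * Real.exp (-(w.1 * (1 + w.2 ^ 2))) : ℝ)

lemma coneGaussian_eq_zero {w : ℝ × ℝ} (hw : w.1 ≤ 0) : coneGaussian w = 0 := by
  simp [coneGaussian, Real.sqrt_eq_zero_of_nonpos hw]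

lemma contDiffAt_coneGaussian {w : ℝ × ℝ} (hw : 0 < w.1) : ContDiffAt ℝ ∞ coneGaussian w := by
  refine Complex.ofRealCLM.contDiff.contDiffAt.comp w (f := fun w : ℝ × ℝ =>
    √w.1 * Real.exp (-(w.1 * (1 + w.2 ^ 2)))) ?_
  have h1 : ContDiffAt ℝ ∞ (fun w : ℝ × ℝ => √w.1) w := contDiffAt_fst.sqrt hw.ne'
  have h2 : ContDiff ℝ ∞ (fun w : ℝ × ℝ => Real.exp (-(w.1 * (1 + w.2 ^ 2)))) := by fun_prop
  exact h1.mul h2.contDiffAt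

lemma measurable_coneGaussian : Measurable coneGaussian := by
  unfold coneGaussian; fun_prop

lemma norm_coneGaussian (w : ℝ × ℝ) :
    ‖coneGaussian w‖ = √w.1 * Real.exp (-(w.1 * (1 + w.2 ^ 2))) := by
  rw [coneGaussian, Complex.norm_real, Real.norm_of_nonneg (by positivity)]

lemma norm_coneGaussian_le_one (w : ℝ × ℝ) : ‖coneGaussian w‖ ≤ 1 := by
  by_cases hw : w.1 ≤ 0
  · simp [coneGaussian_eq_zero hw]
  rw [not_le] at hw
  rw [norm_coneGaussian, Real.exp_neg, ← div_eq_mul_inv, div_le_one (Real.exp_pos _)]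
  have h1 : √w.1 ≤ w.1 + 1 := by
    rw [Real.sqrt_le_left (by linarith)]
    nlinarith
  have h2 := Real.add_one_le_exp (w.1 * (1 + w.2 ^ 2))
  nlinarith [mul_nonneg hw.le (sq_nonneg w.2)]

lemma norm_coneGaussian_mk {r : ℝ} (s : ℝ) :
    ‖coneGaussian (r, s)‖ = √r * Real.exp (-r) * Real.exp (-r * s ^ 2) := by
  rw [norm_coneGaussian, mul_assoc, ← Real.exp_add]
  congr 2
  ring

/-- The integral in `s` is `√(π/r)`, and its singularity at `r = 0` is cancelled by the weight `√r`,
leaving `√π e^{-r}`. -/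
lemma integrable_coneGaussian : Integrable coneGaussian := by
  have hm := measurable_coneGaussian.aestronglyMeasurable (μ := (volume : Measure (ℝ × ℝ)))
  refine (integrable_prod_iff hm).mpr ⟨Eventually.of_forall fun r => ?_, ?_⟩
  · by_cases hr : r ≤ 0
    · simp [coneGaussian_eq_zero (w := (r, _)) hr]
    · rw [not_le] at hr
      refine Integrable.mono' ((integrable_exp_neg_mul_sq hr).const_mul (√r * Real.exp (-r)))
        (measurable_coneGaussian.comp measurable_prodMk_left).aestronglyMeasurable
        (Eventually.of_forall fun s => (norm_coneGaussian_mk s).le)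
  · have : (fun r : ℝ => ∫ s, ‖coneGaussian (r, s)‖) =
        (Ioi 0).indicator fun r => √Real.pi * Real.exp (-r) := by
      funext r
      by_cases hr : 0 < r
      · simp only [norm_coneGaussian_mk]
        rw [indicator_of_mem (show r ∈ Ioi 0 from hr), integral_const_mul, integral_gaussian,
          Real.sqrt_div Real.pi_pos.le]
        have : √r ≠ 0 := (Real.sqrt_pos.mpr hr).ne'
        field_simp
      · rw [indicator_of_notMem (show r ∉ Ioi 0 from hr)]
        simp [coneGaussian_eq_zero (w := (r, _)) (not_lt.mp hr)]
    rw [this, integrable_indicator_iff measurableSet_Ioi]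
    exact (integrableOn_exp_neg_Ioi 0).const_mul _

lemma memLp_coneGaussian {p : ℝ≥0∞} (hp : 1 ≤ p) : MemLp coneGaussian p volume := by
  have hm := measurable_coneGaussian.aestronglyMeasurable (μ := (volume : Measure (ℝ × ℝ)))
  by_cases hpt : p = ⊤
  · subst hpt
    exact memLp_top_of_bound hm 1 (Eventually.of_forall norm_coneGaussian_le_one)
  · rw [← integrable_norm_rpow_iff hm (one_pos.trans_le hp).ne' hpt]
    have hp1 : 1 ≤ p.toReal := by
      rw [← ENNReal.toReal_one]
      exact (ENNReal.toReal_le_toReal ENNReal.one_ne_top hpt).mpr hp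
    refine integrable_coneGaussian.norm.mono' ?_ (Eventually.of_forall fun w => ?_)
    · exact (measurable_coneGaussian.norm.pow_const _).aestronglyMeasurable
    · rw [Real.norm_of_nonneg (by positivity)]
      exact Real.rpow_le_self_of_le_one (norm_nonneg _) (norm_coneGaussian_le_one w) hp1

/-- The denominator of the extension of `coneGaussian`. -/
noncomputable def coneDenominator (z : ℝ × ℝ × ℝ) : ℂ :=
  1 - Complex.I * z.2.2 + z.2.1 ^ 2 / (4 * (1 + z.1 * Complex.I))

lemma coneDenominator_eq (z : ℝ × ℝ × ℝ) : coneDenominator z =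
    ((1 + z.2.1 ^ 2 / (4 * (1 + z.1 ^ 2)) : ℝ) : ℂ) +
      ((-(z.2.2 + z.2.1 ^ 2 * z.1 / (4 * (1 + z.1 ^ 2))) : ℝ) : ℂ) * Complex.I := by
  have h0 : (1 : ℝ) + z.1 ^ 2 ≠ 0 := by positivity
  have h0' : (1 : ℂ) + (z.1 : ℂ) ^ 2 ≠ 0 := by exact_mod_cast h0
  have hne : (1 + (z.1 : ℂ) * Complex.I) ≠ 0 := fun h => by
    have := congrArg Complex.re h
    simp at this
  have h1 : ((1 : ℂ) + z.1 * Complex.I)⁻¹ = (1 - z.1 * Complex.I) / (1 + (z.1 : ℂ) ^ 2) := by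
    field_simp
    ring_nf
    simp
  rw [coneDenominator, div_eq_mul_inv, mul_inv, h1]
  push_cast
  field_simp
  ring

/-- The Gaussian integral in `s` produces a factor `r ^ (-1/2)`, which the weight `√r` removes; what
remains is a pure exponential `exp (-D r)` on `r > 0`, with integral `1 / D`. -/
lemma cone_extension_eq (z : ℝ × ℝ × ℝ) : oscillatoryIntegral conePhase coneGaussian z =
    (Real.pi / (1 + z.1 * Complex.I)) ^ (1 / 2 : ℂ) / coneDenominator z := by
  have hb : 0 < (1 + (z.1 : ℂ) * Complex.I).re := by simp
  have hne : (1 + (z.1 : ℂ) * Complex.I) ≠ 0 := fun h => by rw [h] at hb; simp at hb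
  have hpi : (Real.pi : ℂ) ≠ 0 := by exact_mod_cast Real.pi_ne_zero
  have hre : 0 < (coneDenominator z).re := by
    rw [coneDenominator_eq]
    simp only [Complex.add_re, Complex.ofReal_re, Complex.re_ofReal_mul, Complex.I_re, mul_zero,
      add_zero]
    positivity
  have hD : coneDenominator z ≠ 0 := fun h => by rw [h] at hre; simp at hre
  have hint : Integrable fun w => Complex.exp (Complex.I * (conePhase z w : ℂ)) * coneGaussian w := by
    refine integrable_coneGaussian.norm.mono' ?_ (Eventually.of_forall fun w => ?_)
    · have h1 : Measurable (conePhase z) := measurable_conePhase.comp measurable_prodMk_left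
      exact (((measurable_const.mul (Complex.measurable_ofReal.comp h1)).cexp).mul
        measurable_coneGaussian).aestronglyMeasurable
    · rw [norm_exp_I_mul_ofReal_mul]
  have hinner : ∀ r : ℝ, ∫ s : ℝ, Complex.exp (Complex.I * (conePhase z (r, s) : ℂ)) *
      coneGaussian (r, s) = (Ioi (0 : ℝ)).indicator (fun r : ℝ =>
        (Real.pi / (1 + z.1 * Complex.I)) ^ (1 / 2 : ℂ) *
          Complex.exp (-coneDenominator z * r)) r := by
    intro r
    by_cases hr : 0 < r
    · rw [indicator_of_mem (show r ∈ Ioi 0 from hr)]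
      have hrb : 0 < ((r : ℂ) * (1 + z.1 * Complex.I)).re := by
        rw [Complex.re_ofReal_mul]; positivity
      have hg := fourierIntegral_gaussian hrb ((r * z.2.1 : ℝ) : ℂ)
      have hc : (Real.pi / ((r : ℂ) * (1 + z.1 * Complex.I))) =
          ((r⁻¹ : ℝ) : ℂ) * (Real.pi / (1 + z.1 * Complex.I)) := by
        push_cast
        field_simp
      rw [hc, ofReal_mul_cpow_half (inv_pos.mpr hr) (div_ne_zero hpi hne)] at hg
      have he : ∀ s : ℝ, Complex.exp (Complex.I * (conePhase z (r, s) : ℂ)) * coneGaussian (r, s) =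
          ((√r : ℝ) : ℂ) * Complex.exp (-(r * (1 - Complex.I * z.2.2))) *
            (Complex.exp (Complex.I * ((r * z.2.1 : ℝ) : ℂ) * s) *
              Complex.exp (-((r : ℂ) * (1 + z.1 * Complex.I)) * s ^ 2)) := by
        intro s
        simp only [conePhase, coneGaussian]
        push_cast
        rw [mul_left_comm, mul_assoc (√r : ℂ), ← Complex.exp_add, ← Complex.exp_add,
          ← Complex.exp_add]
        congr 2
        ring
      simp only [he]
      rw [integral_const_mul, hg]
      have hs : ((√r : ℝ) : ℂ) * ((√(r⁻¹) : ℝ) : ℂ) = 1 := by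
        rw [← Complex.ofReal_mul, ← Real.sqrt_mul hr.le, mul_inv_cancel₀ hr.ne', Real.sqrt_one,
          Complex.ofReal_one]
      have hx : Complex.exp (-coneDenominator z * r) =
          Complex.exp (-(r * (1 - Complex.I * z.2.2))) *
          Complex.exp (-((r * z.2.1 : ℝ) : ℂ) ^ 2 / (4 * (r * (1 + z.1 * Complex.I)))) := by
        rw [← Complex.exp_add]
        congr 1
        have hr0 : (r : ℂ) ≠ 0 := by exact_mod_cast hr.ne'
        rw [coneDenominator]
        push_cast
        field_simp
        ring
      rw [hx]
      linear_combination (Complex.exp (-(r * (1 - Complex.I * z.2.2))) *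
        Complex.exp (-((r * z.2.1 : ℝ) : ℂ) ^ 2 / (4 * (r * (1 + z.1 * Complex.I)))) *
        (Real.pi / (1 + z.1 * Complex.I)) ^ (1 / 2 : ℂ)) * hs
    · rw [indicator_of_notMem (show r ∉ Ioi 0 from hr)]
      simp [coneGaussian_eq_zero (w := (r, _)) (not_lt.mp hr)]
  have h1 : oscillatoryIntegral conePhase coneGaussian z = ∫ r : ℝ, ∫ s : ℝ,
      Complex.exp (Complex.I * (conePhase z (r, s) : ℂ)) * coneGaussian (r, s) :=
    integral_prod _ hint
  rw [h1]
  simp only [hinner]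
  rw [integral_indicator measurableSet_Ioi, integral_const_mul,
    integral_exp_mul_complex_Ioi (by simpa using hre)]
  simp
  rfl

lemma norm_cone_extension (z : ℝ × ℝ × ℝ) : ‖oscillatoryIntegral conePhase coneGaussian z‖ =
    √(Real.pi / √(1 + z.1 ^ 2)) / ‖coneDenominator z‖ := by
  rw [cone_extension_eq, norm_div, norm_cpow_half, norm_div, norm_one_add_mul_I,
    Complex.norm_real, Real.norm_of_nonneg Real.pi_pos.le]

lemma coneDenominator_ne_zero (z : ℝ × ℝ × ℝ) : coneDenominator z ≠ 0 := by
  intro h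
  have := congrArg Complex.re h
  rw [coneDenominator_eq] at this
  simp only [Complex.add_re, Complex.ofReal_re, Complex.re_ofReal_mul, Complex.I_re, mul_zero,
    add_zero, Complex.zero_re] at this
  have h2 : 0 ≤ z.2.1 ^ 2 / (4 * (1 + z.1 ^ 2)) := by positivity
  linarith

lemma eLpNorm_cone_extension_ne_zero {q : ℝ≥0∞} (hq : q ≠ 0) :
    eLpNorm (oscillatoryIntegral conePhase coneGaussian) q volume ≠ 0 := by
  refine eLpNorm_ne_zero_of_forall_ne_zero (stronglyMeasurable_oscillatoryIntegral
    measurable_conePhase measurable_coneGaussian) (fun z h0 => ?_) hq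
  have h := norm_cone_extension z
  rw [h0, norm_zero] at h
  have h1 : 0 < ‖coneDenominator z‖ := norm_pos_iff.mpr (coneDenominator_ne_zero z)
  have : 0 < √(Real.pi / √(1 + z.1 ^ 2)) / ‖coneDenominator z‖ := by positivity
  linarith

/-- The extension is `≳ V ^ (-1/2)` on a unit neighbourhood in `U` of a curve over `|X| ≤ V`, so the
fourth power integrates over each slice to `≳ V / V² = 1/V`. -/
lemma eLpNorm_cone_extension_eq_top :
    eLpNorm (oscillatoryIntegral conePhase coneGaussian) 4 volume = ⊤ := by
  refine eLpNorm_natCast_eq_top (q := 4) (by norm_num) ?_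
  have hm := (stronglyMeasurable_oscillatoryIntegral
    measurable_conePhase measurable_coneGaussian).measurable
  -- The centre `h V X` is the zero in `U` of the imaginary part of the denominator. The constant
  -- comes from `‖D‖⁴ ≤ 16` and `1 + V² ≤ 2 V²`.
  refine lintegral_eq_top_of_slices (by fun_prop) (c := Real.pi ^ 2 / 32)
    (by positivity) (l := fun _ => 1) (h := fun V X => -(X ^ 2 * V / (4 * (1 + V ^ 2))))
    (fun V hV => one_pos) ?_
  intro V hV X U hX hU
  refine ENNReal.ofReal_le_ofReal ?_
  rw [norm_cone_extension, div_pow]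
  have hX2 : X ^ 2 ≤ V ^ 2 := sq_le_sq' (abs_le.mp hX).1 (abs_le.mp hX).2
  have hs : 0 ≤ Real.pi / √(1 + V ^ 2) := by positivity
  have h1 : √(Real.pi / √(1 + V ^ 2)) ^ 4 = Real.pi ^ 2 / (1 + V ^ 2) := by
    have : √(Real.pi / √(1 + V ^ 2)) ^ 4 = (√(Real.pi / √(1 + V ^ 2)) ^ 2) ^ 2 := by ring
    rw [this, Real.sq_sqrt hs, div_pow, Real.sq_sqrt (by positivity)]
  -- The real part is at most `5/4` and the imaginary part at most `1` in modulus.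
  have hD : ‖coneDenominator (V, X, U)‖ ^ 2 ≤ 4 := by
    rw [coneDenominator_eq, Complex.sq_norm, Complex.normSq_add_mul_I]
    have h3 : X ^ 2 / (4 * (1 + V ^ 2)) ≤ 1 / 4 := by
      rw [div_le_iff₀ (by positivity)]; linarith
    have h3' : 0 ≤ X ^ 2 / (4 * (1 + V ^ 2)) := by positivity
    rw [sub_neg_eq_add] at hU
    obtain ⟨h4, h5⟩ := abs_le.mp hU
    simp only
    nlinarith
  have hD4 : ‖coneDenominator (V, X, U)‖ ^ 4 ≤ 16 := by
    have : ‖coneDenominator (V, X, U)‖ ^ 4 = (‖coneDenominator (V, X, U)‖ ^ 2) ^ 2 := by ring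
    rw [this]
    nlinarith [sq_nonneg ‖coneDenominator (V, X, U)‖]
  have hDp : 0 < ‖coneDenominator (V, X, U)‖ := norm_pos_iff.mpr (coneDenominator_ne_zero _)
  rw [h1, div_div, div_div]
  refine div_le_div_of_nonneg_left (by positivity) (by positivity) ?_
  have : (1 + V ^ 2) * ‖coneDenominator (V, X, U)‖ ^ 4 ≤ (1 + V ^ 2) * 16 := by gcongr
  nlinarith

/-! ### Lorentz boosts and the case `q < p` -/

lemma IsChartAmplitude.integrable {g : ℝ × ℝ → ℂ} (hg : IsChartAmplitude g) : Integrable g := by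
  obtain ⟨hgs, K, -, hK, hgK⟩ := hg
  exact hgs.continuous.integrable_of_hasCompactSupport
    (HasCompactSupport.of_support_subset_isCompact hK hgK)

lemma IsChartAmplitude.eLpNorm_ne_top {g : ℝ × ℝ → ℂ} (hg : IsChartAmplitude g) (p : ℝ≥0∞) :
    eLpNorm g p volume ≠ ⊤ := by
  obtain ⟨hgs, K, -, hK, hgK⟩ := hg
  exact (hgs.continuous.memLp_of_hasCompactSupport
    (HasCompactSupport.of_support_subset_isCompact hK hgK)).eLpNorm_lt_top.ne

lemma IsChartAmplitude.add {g h : ℝ × ℝ → ℂ} (hg : IsChartAmplitude g) (hh : IsChartAmplitude h) :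
    IsChartAmplitude fun w => g w + h w := by
  obtain ⟨hgs, K, hKD, hK, hgK⟩ := hg
  obtain ⟨hhs, K', hKD', hK', hhK⟩ := hh
  refine ⟨hgs.add hhs, K ∪ K', union_subset hKD hKD', hK.union hK', fun w hw => ?_⟩
  by_cases h0 : g w = 0
  · exact Or.inr (hhK fun h1 => hw (by simp [h0, h1]))
  · exact Or.inl (hgK h0)

/-- The amplitude `g` moved by the Lorentz boost `ρ ↦ l ρ` and modulated, so that its extension is
translated by `R`. -/
noncomputable def boost (l R : ℝ) (g : ℝ × ℝ → ℂ) (w : ℝ × ℝ) : ℂ :=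
  Complex.exp (Complex.I * ((-(R * w.1) : ℝ) : ℂ)) * g (l⁻¹ * w.1, l * w.2)

lemma norm_boost (l R : ℝ) (g : ℝ × ℝ → ℂ) (w : ℝ × ℝ) :
    ‖boost l R g w‖ = ‖g (l⁻¹ * w.1, l * w.2)‖ := norm_exp_I_mul_ofReal_mul _ _

lemma IsChartAmplitude.boost {g : ℝ × ℝ → ℂ} (hg : IsChartAmplitude g) {l : ℝ} (hl : 1 ≤ l)
    (R : ℝ) : IsChartAmplitude (boost l R g) := by
  obtain ⟨hgs, K, hKD, hK, hgK⟩ := hg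
  have hl0 : l ≠ 0 := by linarith
  refine ⟨?_, (fun w : ℝ × ℝ => (l * w.1, l⁻¹ * w.2)) '' K, ?_, hK.image (by fun_prop), ?_⟩
  · have h1 : ContDiff ℝ ∞ fun w : ℝ × ℝ => Complex.exp (Complex.I * ((-(R * w.1) : ℝ) : ℂ)) := by
      refine (contDiff_const.mul (Complex.ofRealCLM.contDiff.comp ?_)).cexp
      exact (contDiff_const.mul contDiff_fst).neg
    exact h1.mul (hgs.comp (by fun_prop))
  · rintro _ ⟨w, hw, rfl⟩
    have h1 : 1 < w.1 := hKD hw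
    change 1 < l * w.1
    nlinarith
  · intro w hw
    refine ⟨(l⁻¹ * w.1, l * w.2), hgK fun h0 => hw ?_, ?_⟩
    · rw [← norm_eq_zero, norm_boost, h0, norm_zero]
    · ext <;> simp <;> field_simp

lemma eLpNorm_boost {l : ℝ} (hl : 0 < l) (R : ℝ) (g : ℝ × ℝ → ℂ) (p : ℝ≥0∞) :
    eLpNorm (boost l R g) p volume = eLpNorm g p volume := by
  have h0 := eLpNorm_comp_homeomorph (diagonalAffine (inv_pos.mpr hl).ne' hl.ne' 0)
    (c := 1) one_ne_zero (by
      have h := map_affine_volume_prod (inv_pos.mpr hl).ne' hl.ne' 0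
      rw [inv_mul_cancel₀ hl.ne', inv_one, abs_one, ENNReal.ofReal_one] at h
      exact h) g p
  rw [ENNReal.one_rpow, one_mul] at h0
  rw [← h0]
  refine eLpNorm_congr_norm_ae (Eventually.of_forall fun w => ?_)
  rw [norm_boost]
  simp [diagonalAffine_apply]

/-- The substitution `(ρ, s) ↦ (l ρ, s / l)` preserves area, fixes `ρ s` and divides `1/ρ - ρ s²` by
`l`, so on the physical side it is a linear map of determinant one. -/
lemma oscillatoryIntegral_boost {g : ℝ × ℝ → ℂ} {l : ℝ} (hl : 0 < l) (R : ℝ) (z : ℝ × ℝ × ℝ) :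
    oscillatoryIntegral chartPhase (boost l R g) z =
      oscillatoryIntegral chartPhase g (l⁻¹ * z.1, z.2.1, l * (z.2.2 - R)) := by
  have h1 := (diagonalAffine hl.ne' (inv_pos.mpr hl).ne' 0).measurableEmbedding.integral_map
    (μ := volume) (fun w => Complex.exp (Complex.I * (chartPhase z w : ℂ)) * boost l R g w)
  have h2 := map_affine_volume_prod hl.ne' (inv_pos.mpr hl).ne' 0
  rw [mul_inv_cancel₀ hl.ne', inv_one, abs_one, ENNReal.ofReal_one, one_smul] at h2
  have h3 : (volume : Measure (ℝ × ℝ)).map (diagonalAffine hl.ne' (inv_pos.mpr hl).ne' 0) = volume :=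
    h2
  rw [h3] at h1
  rw [oscillatoryIntegral, h1, oscillatoryIntegral]
  refine integral_congr_ae (Eventually.of_forall fun w => ?_)
  have h4 : l⁻¹ * (l * w.1) = w.1 := by field_simp
  have h5 : l * (l⁻¹ * w.2) = w.2 := by field_simp
  simp only [diagonalAffine_apply, boost, zero_add, h4, h5]
  rw [← mul_assoc, ← Complex.exp_add, ← mul_add, ← Complex.ofReal_add]
  congr 4
  simp only [chartPhase, nullHeight]
  by_cases hw : w.1 = 0
  · simp [hw]
  · field_simp
    ring

lemma oscillatoryIntegral_add {φ : ℝ × ℝ × ℝ → ℝ × ℝ → ℝ} (hφ : Measurable (Function.uncurry φ))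
    {g h : ℝ × ℝ → ℂ} (hg : Integrable g) (hh : Integrable h) (z : ℝ × ℝ × ℝ) :
    oscillatoryIntegral φ (fun w => g w + h w) z =
      oscillatoryIntegral φ g z + oscillatoryIntegral φ h z := by
  have hm : Measurable (φ z) := hφ.comp measurable_prodMk_left
  have hi : ∀ {f : ℝ × ℝ → ℂ}, Integrable f →
      Integrable fun w => Complex.exp (Complex.I * (φ z w : ℂ)) * f w := fun {f} hf => by
    refine hf.bdd_mul (c := 1) (by fun_prop) (Eventually.of_forall fun w => ?_)
    rw [Complex.norm_exp_I_mul_ofReal]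
  simp only [oscillatoryIntegral, mul_add]
  exact integral_add (hi hg) (hi hh)

/-- Riemann-Lebesgue in the null direction. -/
lemma tendsto_oscillatoryIntegral_cocompact {g : ℝ × ℝ → ℂ} (hg : Integrable g) (v x : ℝ) :
    Tendsto (fun u : ℝ => oscillatoryIntegral chartPhase g (v, x, u)) (cocompact ℝ) (𝓝 0) := by
  have hm : ∀ z, Measurable (chartPhase z) := fun z =>
    measurable_chartPhase.comp measurable_prodMk_left
  have hi : ∀ z, Integrable fun w => Complex.exp (Complex.I * (chartPhase z w : ℂ)) * g w := fun z => by
    have := hm z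
    refine hg.bdd_mul (c := 1) (by fun_prop) (Eventually.of_forall fun w => ?_)
    rw [Complex.norm_exp_I_mul_ofReal]
  have h1 : ∀ u, oscillatoryIntegral chartPhase g (v, x, u) =
      ∫ s : ℝ, ∫ r : ℝ, Complex.exp (Complex.I * (chartPhase (v, x, u) (r, s) : ℂ)) * g (r, s) :=
    fun u => integral_prod_symm _ (hi _)
  have hdec : ∀ s : ℝ, Tendsto (fun u : ℝ =>
      ∫ r : ℝ, Complex.exp (Complex.I * (chartPhase (v, x, u) (r, s) : ℂ)) * g (r, s))
      (cocompact ℝ) (𝓝 0) := by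
    intro s
    have h2 := Real.tendsto_integral_exp_smul_cocompact fun r : ℝ =>
      Complex.exp (Complex.I * (chartPhase (v, x, 0) (r, s) : ℂ)) * g (r, s)
    -- Converts the Fourier normalisation `e^{-2πi r w}` into `e^{i u r}`.
    have hpi : -(2 * Real.pi)⁻¹ ≠ 0 := by
      have := Real.pi_pos
      simp [this.ne']
    have h3 := h2.comp (Homeomorph.mulLeft₀ (-(2 * Real.pi)⁻¹) hpi).isClosedEmbedding.tendsto_cocompact
    refine h3.congr fun u => ?_
    refine integral_congr_ae (Eventually.of_forall fun r => ?_)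
    simp only [Homeomorph.coe_mulLeft₀, Circle.smul_def, Real.fourierChar_apply, smul_eq_mul]
    rw [← mul_assoc, ← Complex.exp_add]
    congr 2
    simp only [chartPhase]
    have hpc : (Real.pi : ℂ) ≠ 0 := by exact_mod_cast Real.pi_ne_zero
    push_cast
    field_simp
    ring
  simp only [h1]
  have hcg : (cocompact ℝ).IsCountablyGenerated := by
    rw [cocompact_eq_atBot_atTop]
    infer_instance
  have h4 := tendsto_integral_filter_of_dominated_convergence (l := cocompact ℝ) (μ := volume)
    (F := fun u s => ∫ r : ℝ, Complex.exp (Complex.I * (chartPhase (v, x, u) (r, s) : ℂ)) * g (r, s))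
    (f := fun _ => 0) (fun s => ∫ r, ‖g (r, s)‖)
    (Eventually.of_forall fun u => ((hi (v, x, u)).swap.integral_prod_left).aestronglyMeasurable)
    (Eventually.of_forall fun u => Eventually.of_forall fun s => ?_)
    hg.norm.swap.integral_prod_left (Eventually.of_forall hdec)
  · simpa using h4
  · refine (norm_integral_le_integral_norm _).trans (le_of_eq ?_)
    simp only [norm_exp_I_mul_ofReal_mul]

/-- The `p`-th powers add pointwise, so no triangle inequality is used and `p < 1` is allowed; for
`p = ∞` the factor is `2 ^ 0 = 1`. -/
lemma eLpNorm_add_le_of_disjoint {f g : ℝ × ℝ → ℂ} (hf : Measurable f)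
    (h : ∀ w, f w = 0 ∨ g w = 0) {p N : ℝ≥0∞} (hp : p ≠ 0) (hfN : eLpNorm f p volume = N)
    (hgN : eLpNorm g p volume = N) :
    eLpNorm (fun w => f w + g w) p volume ≤ 2 ^ (1 / p).toReal * N := by
  by_cases hpt : p = ⊤
  · subst hpt
    simp only [ENNReal.div_top, ENNReal.toReal_zero, ENNReal.rpow_zero, one_mul]
    rw [eLpNorm_exponent_top] at hfN hgN ⊢
    refine essSup_le_of_ae_le _ ?_
    filter_upwards [enorm_ae_le_eLpNormEssSup f volume, enorm_ae_le_eLpNormEssSup g volume]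
      with w h1 h2
    rcases h w with h0 | h0
    · simpa [h0, hgN] using h2
    · simpa [h0, hfN] using h1
  · have hpp := ENNReal.toReal_pos hp hpt
    have hpi : (1 / p).toReal = 1 / p.toReal := by simp
    rw [eLpNorm_eq_lintegral_rpow_enorm_toReal hp hpt] at hfN hgN ⊢
    have h1 : ∀ w, ‖f w + g w‖ₑ ^ p.toReal = ‖f w‖ₑ ^ p.toReal + ‖g w‖ₑ ^ p.toReal := fun w => by
      rcases h w with h0 | h0 <;> simp [h0, hpp]
    have h2 : ∀ {I : ℝ≥0∞}, I ^ (1 / p.toReal) = N → I = N ^ p.toReal := fun {I} hI => by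
      rw [← hI, ← ENNReal.rpow_mul, one_div_mul_cancel hpp.ne', ENNReal.rpow_one]
    simp only [h1]
    rw [lintegral_add_left (by fun_prop), h2 hfN, h2 hgN, ← two_mul,
      ENNReal.mul_rpow_of_nonneg _ _ (by positivity), ← ENNReal.rpow_mul,
      mul_one_div_cancel hpp.ne', ENNReal.rpow_one, hpi]

/-- Two functions translated far apart contribute independently to the `L^q` norm. -/
lemma lintegral_add_lintegral_le_of_translates {H H₁ : ℝ × ℝ × ℝ → ℂ} (hH : Measurable H)
    (hH₁ : Measurable H₁)
    (hdec : ∀ v x, Tendsto (fun u : ℝ => H (v, x, u)) (cocompact ℝ) (𝓝 0))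
    (hdec₁ : ∀ v x, Tendsto (fun u : ℝ => H₁ (v, x, u)) (cocompact ℝ) (𝓝 0)) {q : ℝ} {M : ℝ≥0∞}
    (hM : ∀ n : ℕ, ∫⁻ z : ℝ × ℝ × ℝ, ‖H z + H₁ (z.1, z.2.1, z.2.2 - n)‖ₑ ^ q ≤ M) :
    (∫⁻ z, ‖H z‖ₑ ^ q) + ∫⁻ z, ‖H₁ z‖ₑ ^ q ≤ M := by
  -- Space is cut halfway between the two bumps, at `u = n/2`. The upper half, moved back by `n`,
  -- becomes `T n`; each half then converges pointwise to one summand and Fatou applies.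
  let S : ℕ → Set (ℝ × ℝ × ℝ) := fun n => {z | z.2.2 < (n : ℝ) / 2}
  have hS : ∀ n, MeasurableSet (S n) := fun n =>
    measurableSet_lt (by fun_prop) measurable_const
  let T : ℕ → Set (ℝ × ℝ × ℝ) := fun n => {z | -((n : ℝ) / 2) ≤ z.2.2}
  have hT : ∀ n, MeasurableSet (T n) := fun n =>
    measurableSet_le measurable_const (by fun_prop)
  let a : ℕ → ℝ × ℝ × ℝ → ℝ≥0∞ := fun n =>
    (S n).indicator fun z => ‖H z + H₁ (z.1, z.2.1, z.2.2 - n)‖ₑ ^ q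
  let b : ℕ → ℝ × ℝ × ℝ → ℝ≥0∞ := fun n =>
    (T n).indicator fun z => ‖H (z.1, z.2.1, z.2.2 + n) + H₁ z‖ₑ ^ q
  have ham : ∀ n, Measurable (a n) := fun n => Measurable.indicator (by fun_prop) (hS n)
  have hbm : ∀ n, Measurable (b n) := fun n => Measurable.indicator (by fun_prop) (hT n)
  have hsum : ∀ n, ∫⁻ z, a n z + b n z ≤ M := by
    intro n
    refine le_trans (le_of_eq ?_) (hM n)
    rw [lintegral_add_left (ham n), lintegral_indicator (hS n), ← lintegral_add_compl (μ := volume)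
      (fun z : ℝ × ℝ × ℝ => ‖H z + H₁ (z.1, z.2.1, z.2.2 - n)‖ₑ ^ q) (hS n)]
    congr 1
    rw [← lintegral_indicator (hS n).compl,
      ← lintegral_add_right_eq_self ((S n)ᶜ.indicator fun z : ℝ × ℝ × ℝ =>
        ‖H z + H₁ (z.1, z.2.1, z.2.2 - n)‖ₑ ^ q) ((0, 0, (n : ℝ)) : ℝ × ℝ × ℝ)]
    refine lintegral_congr fun z => ?_
    have hiff : z ∈ T n ↔ z + (0, 0, (n : ℝ)) ∈ (S n)ᶜ := by
      simp only [T, S, mem_compl_iff, mem_ofPred_eq, not_lt, Prod.snd_add]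
      constructor <;> intro h <;> linarith
    by_cases hz : z ∈ T n
    · simp only [b]
      rw [indicator_of_mem hz, indicator_of_mem (hiff.mp hz)]
      have he : z + (0, 0, (n : ℝ)) = (z.1, z.2.1, z.2.2 + n) := by ext <;> simp
      rw [he, add_sub_cancel_right]
    · simp only [b]
      rw [indicator_of_notMem hz, indicator_of_notMem fun h => hz (hiff.mpr h)]
  have hcoc : ∀ u : ℝ, Tendsto (fun n : ℕ => u - n) atTop (cocompact ℝ) := fun u => by
    refine Tendsto.mono_right ?_ (atBot_le_cocompact (α := ℝ))
    exact tendsto_atBot_add_const_left _ u (tendsto_neg_atTop_atBot.comp tendsto_natCast_atTop_atTop)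
  have hcoc' : ∀ u : ℝ, Tendsto (fun n : ℕ => u + n) atTop (cocompact ℝ) := fun u => by
    refine Tendsto.mono_right ?_ (atTop_le_cocompact (α := ℝ))
    exact tendsto_atTop_add_const_left _ u tendsto_natCast_atTop_atTop
  have hatend : ∀ z, Tendsto (fun n => a n z) atTop (𝓝 (‖H z‖ₑ ^ q)) := by
    intro z
    have h1 : Tendsto (fun n : ℕ => H z + H₁ (z.1, z.2.1, z.2.2 - n)) atTop (𝓝 (H z)) := by
      simpa using ((hdec₁ z.1 z.2.1).comp (hcoc z.2.2)).const_add (H z)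
    have h2 : Tendsto (fun n : ℕ => ‖H z + H₁ (z.1, z.2.1, z.2.2 - n)‖ₑ ^ q) atTop
        (𝓝 (‖H z‖ₑ ^ q)) :=
      (ENNReal.continuous_rpow_const.tendsto _).comp h1.enorm
    refine h2.congr' ?_
    filter_upwards [eventually_gt_atTop ⌈2 * z.2.2⌉₊] with n hn
    have h3 : 2 * z.2.2 < n := Nat.lt_of_ceil_lt hn
    have h4 : z ∈ S n := by
      change z.2.2 < (n : ℝ) / 2
      linarith
    simp only [a]
    rw [indicator_of_mem h4]
  have hbtend : ∀ z, Tendsto (fun n => b n z) atTop (𝓝 (‖H₁ z‖ₑ ^ q)) := by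
    intro z
    have h1 : Tendsto (fun n : ℕ => H (z.1, z.2.1, z.2.2 + n) + H₁ z) atTop (𝓝 (H₁ z)) := by
      simpa using ((hdec z.1 z.2.1).comp (hcoc' z.2.2)).add_const (H₁ z)
    have h2 : Tendsto (fun n : ℕ => ‖H (z.1, z.2.1, z.2.2 + n) + H₁ z‖ₑ ^ q) atTop
        (𝓝 (‖H₁ z‖ₑ ^ q)) :=
      (ENNReal.continuous_rpow_const.tendsto _).comp h1.enorm
    refine h2.congr' ?_
    filter_upwards [eventually_ge_atTop ⌈-(2 * z.2.2)⌉₊] with n hn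
    have h3 : -(2 * z.2.2) ≤ n := Nat.ceil_le.mp hn
    have h4 : z ∈ T n := by
      change -((n : ℝ) / 2) ≤ z.2.2
      linarith
    simp only [b]
    rw [indicator_of_mem h4]
  rw [← lintegral_add_left (by fun_prop)]
  calc ∫⁻ z, ‖H z‖ₑ ^ q + ‖H₁ z‖ₑ ^ q
      = ∫⁻ z, liminf (fun n => a n z + b n z) atTop :=
        lintegral_congr fun z => ((hatend z).add (hbtend z)).liminf_eq.symm
    _ ≤ liminf (fun n => ∫⁻ z, a n z + b n z) atTop :=
        lintegral_liminf_le fun n => (ham n).add (hbm n)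
    _ ≤ liminf (fun _ : ℕ => M) atTop := liminf_le_liminf (Eventually.of_forall hsum)
    _ = M := liminf_const M

/-- Adding a boosted copy of the amplitude improves the constant when `q < p`. -/
theorem ChartBound.doubling {p q C : ℝ≥0∞} (hC : ChartBound p q C) (hp : p ≠ 0) (hq : q ≠ 0)
    (hqt : q ≠ ⊤) : ChartBound p q (2 ^ ((1 / p).toReal - (1 / q).toReal) * C) := by
  intro g hg
  obtain ⟨hgs, K, hKD, hK, hgK⟩ := id hg
  obtain ⟨M, hM⟩ := hK.exists_bound_of_continuousOn (f := fun w : ℝ × ℝ => w.1)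
    continuous_fst.continuousOn
  -- The amplitude lives in `1 < ρ ≤ l` and its boost in `ρ > l`, hence the disjointness.
  set l : ℝ := max M 1
  have hl1 : 1 ≤ l := le_max_right _ _
  have hl : 0 < l := one_pos.trans_le hl1
  have hdisj : ∀ (R : ℝ) (w : ℝ × ℝ), g w = 0 ∨ boost l R g w = 0 := by
    intro R w
    by_contra! h
    have h1 : g (l⁻¹ * w.1, l * w.2) ≠ 0 := fun h0 => h.2 (by
      rw [← norm_eq_zero, norm_boost, h0, norm_zero])
    have h2 : 1 < l⁻¹ * w.1 := hKD (hgK h1)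
    have h3 : w.1 ≤ l := (le_abs_self _).trans ((hM w (hgK h.1)).trans (le_max_left _ _))
    rw [inv_mul_eq_div, one_lt_div hl] at h2
    linarith
  set H := oscillatoryIntegral chartPhase g with hH
  let H₁ : ℝ × ℝ × ℝ → ℂ := fun z => H (l⁻¹ * z.1, 1 * z.2.1, l * z.2.2)
  have hHm : Measurable H :=
    (stronglyMeasurable_oscillatoryIntegral measurable_chartPhase hgs.continuous.measurable).measurable
  have hdec := tendsto_oscillatoryIntegral_cocompact hg.integrable
  have hqp := ENNReal.toReal_pos hq hqt
  have hqi : (1 / q).toReal = 1 / q.toReal := by simp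
  set N := 2 ^ (1 / p).toReal * C * eLpNorm g p volume
  have hpow : ∀ f : ℝ × ℝ × ℝ → ℂ, ∫⁻ z, ‖f z‖ₑ ^ q.toReal = eLpNorm f q volume ^ q.toReal := fun f => by
    rw [eLpNorm_eq_lintegral_rpow_enorm_toReal hq hqt, ← ENNReal.rpow_mul,
      one_div_mul_cancel hqp.ne', ENNReal.rpow_one]
  have hbd : ∀ n : ℕ, ∫⁻ z : ℝ × ℝ × ℝ, ‖H z + H₁ (z.1, z.2.1, z.2.2 - n)‖ₑ ^ q.toReal ≤
      N ^ q.toReal := by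
    intro n
    have h1 : (fun z : ℝ × ℝ × ℝ => H z + H₁ (z.1, z.2.1, z.2.2 - n)) =
        oscillatoryIntegral chartPhase fun w => g w + boost l n g w := by
      funext z
      rw [oscillatoryIntegral_add measurable_chartPhase hg.integrable (hg.boost hl1 n).integrable,
        oscillatoryIntegral_boost hl]
      simp only [H₁, one_mul, hH]
    rw [hpow, h1]
    gcongr
    refine (hC _ (hg.add (hg.boost hl1 n))).trans ?_
    calc _ ≤ C * (2 ^ (1 / p).toReal * eLpNorm g p volume) := by
          gcongr
          exact eLpNorm_add_le_of_disjoint hgs.continuous.measurable (hdisj n) hp rfl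
            (eLpNorm_boost hl n g p)
      _ = N := by ring
  have hdec₁ : ∀ v x, Tendsto (fun u : ℝ => H₁ (v, x, u)) (cocompact ℝ) (𝓝 0) := fun v x =>
    (hdec (l⁻¹ * v) (1 * x)).comp
      (Homeomorph.mulLeft₀ l hl.ne').isClosedEmbedding.tendsto_cocompact
  have hfin := lintegral_add_lintegral_le_of_translates hHm (by fun_prop) hdec hdec₁ hbd
  have hH₁ : eLpNorm H₁ q volume = eLpNorm H q volume := by
    have h := eLpNorm_comp_scaling (inv_pos.mpr hl).ne' one_ne_zero hl.ne' H q
    rw [mul_one, inv_mul_cancel₀ hl.ne', inv_one, abs_one, ENNReal.ofReal_one, ENNReal.one_rpow,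
      one_mul] at h
    exact h
  rw [hpow, hpow, hH₁, ← two_mul] at hfin
  have h2 : (2 : ℝ≥0∞) ^ (1 / q).toReal * eLpNorm H q volume ≤ N := by
    have h3 := ENNReal.rpow_le_rpow hfin (by positivity : 0 ≤ 1 / q.toReal)
    rwa [ENNReal.mul_rpow_of_nonneg _ _ (by positivity), ← ENNReal.rpow_mul, ← ENNReal.rpow_mul,
      mul_one_div_cancel hqp.ne', ENNReal.rpow_one, ENNReal.rpow_one, ← hqi] at h3
  calc eLpNorm H q volume
      = 2 ^ (-(1 / q).toReal) * (2 ^ (1 / q).toReal * eLpNorm H q volume) := by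
        rw [← mul_assoc, ← ENNReal.rpow_add _ _ two_ne_zero ENNReal.ofNat_ne_top, neg_add_cancel,
          ENNReal.rpow_zero, one_mul]
    _ ≤ 2 ^ (-(1 / q).toReal) * N := by gcongr
    _ = _ := by
        rw [sub_eq_add_neg, ENNReal.rpow_add _ _ two_ne_zero ENNReal.ofNat_ne_top]
        ring

/-- Doubling multiplies the constant by `t = 2 ^ (1/p - 1/q) < 1`, so every `t ^ n * C` is
admissible. -/
theorem ChartBound.eq_zero_of_lt {p q C : ℝ≥0∞} (hC : ChartBound p q C) (hCt : C ≠ ⊤) (hp : p ≠ 0)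
    (hq : q ≠ 0) (hqt : q ≠ ⊤) (hpq : (1 / p).toReal < (1 / q).toReal) : ChartBound p q 0 := by
  set t : ℝ≥0∞ := 2 ^ ((1 / p).toReal - (1 / q).toReal) with ht
  have ht1 : t < 1 := ENNReal.rpow_lt_one_of_one_lt_of_neg ENNReal.one_lt_two (by linarith)
  have hn : ∀ n : ℕ, ChartBound p q (t ^ n * C) := by
    intro n
    induction n with
    | zero => simpa using hC
    | succ n ih =>
      have := ih.doubling hp hq hqt
      rwa [← ht, ← mul_assoc, ← pow_succ'] at this
  intro g hg
  have hfin : C * eLpNorm g p volume ≠ ⊤ := ENNReal.mul_ne_top hCt (hg.eLpNorm_ne_top p)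
  have h0 : Tendsto (fun n : ℕ => t ^ n * (C * eLpNorm g p volume)) atTop (𝓝 0) := by
    have := ENNReal.Tendsto.mul_const (ENNReal.tendsto_pow_atTop_nhds_zero_of_lt_one ht1)
      (Or.inr hfin)
    simpa using this
  rw [zero_mul]
  refine ge_of_tendsto' h0 fun n => ?_
  rw [← mul_assoc]
  exact hn n g hg

/-! ### Necessary conditions and the exponent triangle -/

/-- The Knapp condition `q ≥ 2 p'`. -/
lemma not_extensionBound_of_knapp {p q : ℝ≥0∞} (hp : p ≠ 0) (hq : q ≠ 0)
    (h : 2 < 4 * (1 / q).toReal + 2 * (1 / p).toReal) : ¬ ExtensionBound p q := by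
  intro hE
  obtain ⟨C, hCt, hC⟩ := hE.exists_chartBound
  obtain ⟨κ, -, -, h0⟩ := hC.eLpNorm_saddle_limit rfl contDiff_saddleGaussian
    (memLp_one_iff_integrable.mp (memLp_saddleGaussian one_ne_zero))
  exact eLpNorm_saddle_extension_ne_zero hq
    (h0 hCt (memLp_saddleGaussian hp).eLpNorm_lt_top.ne (Or.inl (by linarith)))

/-- The scaling condition `q ≤ 3 p'`. -/
lemma not_extensionBound_of_scaling {p q : ℝ≥0∞} (hp : 1 ≤ p) (hq : q ≠ 0)
    (h : 3 * (1 / q).toReal + (1 / p).toReal < 1) : ¬ ExtensionBound p q := by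
  intro hE
  obtain ⟨C, hCt, hC⟩ := hE.exists_chartBound
  have h0 := (hC.eLpNorm_cone_limit rfl (fun w => contDiffAt_coneGaussian)
    (fun w => coneGaussian_eq_zero) integrable_coneGaussian).2 hCt
    (memLp_coneGaussian hp).eLpNorm_lt_top.ne (by linarith)
  exact eLpNorm_cone_extension_ne_zero hq h0

/-- The noncompactness condition `q ≥ p`. -/
lemma not_extensionBound_of_lt {p q : ℝ≥0∞} (hp : p ≠ 0) (hq : q ≠ 0) (hqt : q ≠ ⊤)
    (h : (1 / p).toReal < (1 / q).toReal) : ¬ ExtensionBound p q := by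
  intro hE
  obtain ⟨C, hCt, hC⟩ := hE.exists_chartBound
  have hC0 := hC.eq_zero_of_lt hCt hp hq hqt h
  obtain ⟨κ, -, -, h0⟩ := hC0.eLpNorm_saddle_limit rfl contDiff_saddleGaussian
    (memLp_one_iff_integrable.mp (memLp_saddleGaussian one_ne_zero))
  exact eLpNorm_saddle_extension_ne_zero hq
    (h0 ENNReal.zero_ne_top (memLp_saddleGaussian hp).eLpNorm_lt_top.ne (Or.inr rfl))

/-- Here the parabolic scaling exponent is `2 - 4/3 - 2/3 = 0`, so the bound would pass to the
saddle. -/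
lemma not_extensionBound_three_three : ¬ ExtensionBound 3 3 := by
  intro hE
  obtain ⟨C, hCt, hC⟩ := hE.exists_chartBound
  obtain ⟨κ, hκ, h0, -⟩ := hC.eLpNorm_saddle_limit rfl contDiff_saddleGaussian
    (memLp_one_iff_integrable.mp (memLp_saddleGaussian one_ne_zero))
  have h1 := h0 (by norm_num)
  rw [eLpNorm_saddle_extension_eq_top, top_le_iff] at h1
  exact ENNReal.mul_ne_top (ENNReal.mul_ne_top hκ hCt)
    (memLp_saddleGaussian (by norm_num)).eLpNorm_lt_top.ne h1

/-- Here the isotropic scaling exponent is `3/4 + 1/4 - 1 = 0`, so the bound would pass to the cone.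
-/
lemma not_extensionBound_four_four : ¬ ExtensionBound 4 4 := by
  intro hE
  obtain ⟨C, hCt, hC⟩ := hE.exists_chartBound
  have h1 := (hC.eLpNorm_cone_limit rfl (fun w => contDiffAt_coneGaussian)
    (fun w => coneGaussian_eq_zero) integrable_coneGaussian).1 (by norm_num)
  rw [eLpNorm_cone_extension_eq_top, top_le_iff] at h1
  exact ENNReal.mul_ne_top hCt
    (memLp_coneGaussian (by norm_num)).eLpNorm_lt_top.ne h1

/-- The exponent triangle in terms of the reciprocals of the exponents. -/
lemma mem_exponentTriangle_of_inv_le {p q : ℝ≥0∞} (hp : p ≠ 0) (hq : q ≠ 0)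
    (h1 : 4 * (1 / q).toReal + 2 * (1 / p).toReal ≤ 2)
    (h2 : 1 ≤ 3 * (1 / q).toReal + (1 / p).toReal)
    (h3 : (1 / q).toReal ≤ (1 / p).toReal) : (p⁻¹, q⁻¹) ∈ exponentTriangle := by
  rw [one_div, one_div] at h1
  rw [one_div, one_div] at h2 h3
  have hpi : p⁻¹ ≠ ⊤ := ENNReal.inv_ne_top.mpr hp
  have hqi : q⁻¹ ≠ ⊤ := ENNReal.inv_ne_top.mpr hq
  set a := p⁻¹.toReal with ha
  set b := q⁻¹.toReal with hb
  have hb0 : 0 ≤ b := ENNReal.toReal_nonneg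
  have ha0 : 0 ≤ a := ENNReal.toReal_nonneg
  have hpa : p⁻¹ = ENNReal.ofReal a := (ENNReal.ofReal_toReal hpi).symm
  have hqb : q⁻¹ = ENNReal.ofReal b := (ENNReal.ofReal_toReal hqi).symm
  have hc : (ENNReal.ofReal (1 - a))⁻¹⁻¹ = ENNReal.ofReal (1 - a) := inv_inv _
  -- The conjugate exponent is the inverse of `1 - 1/p`; for `p = 1` this is `0⁻¹ = ∞`, as it should
  -- be.
  refine ⟨p, (ENNReal.ofReal (1 - a))⁻¹, q, ⟨?_⟩, ?_, ?_, ?_, rfl⟩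
  · rw [hc, hpa, ← ENNReal.ofReal_add ha0 (by linarith), inv_one]
    simp
  · rw [← ENNReal.inv_le_inv, ENNReal.mul_inv (by simp) (by simp), hc, hqb,
      ← ENNReal.ofReal_ofNat 2, ← ENNReal.ofReal_inv_of_pos two_pos,
      ← ENNReal.ofReal_mul (by norm_num)]
    exact ENNReal.ofReal_le_ofReal (by linarith)
  · rw [← ENNReal.inv_le_inv, ENNReal.mul_inv (by simp) (by simp), hc, hqb,
      ← ENNReal.ofReal_ofNat 3, ← ENNReal.ofReal_inv_of_pos three_pos,
      ← ENNReal.ofReal_mul (by norm_num)]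
    exact ENNReal.ofReal_le_ofReal (by linarith)
  · rw [← ENNReal.inv_le_inv, hpa, hqb]
    exact ENNReal.ofReal_le_ofReal h3

theorem proposition1p2 :
    ¬ ExtensionBound 3 3 ∧ ¬ ExtensionBound 4 4 ∧
      ∀ p q : ℝ≥0∞, 0 < p → 0 < q → (p⁻¹, q⁻¹) ∉ exponentTriangle → ¬ ExtensionBound p q := by
  refine ⟨not_extensionBound_three_three, not_extensionBound_four_four, fun p q hp hq hT => ?_⟩
  by_contra hE
  have h1 : 4 * (1 / q).toReal + 2 * (1 / p).toReal ≤ 2 :=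
    not_lt.mp fun h => not_extensionBound_of_knapp hp.ne' hq.ne' h hE
  -- The Knapp condition already excludes `p < 1`, since it gives `2/p ≤ 2`.
  have hp1 : 1 ≤ p := by
    have hb : 0 ≤ (1 / q).toReal := ENNReal.toReal_nonneg
    have ha : (1 / p).toReal ≤ 1 := by linarith
    have hpi : 1 / p ≠ ⊤ := by simp [hp.ne']
    rw [← ENNReal.toReal_one, ENNReal.toReal_le_toReal hpi ENNReal.one_ne_top, one_div,
      ENNReal.inv_le_one] at ha
    exact ha
  have h2 : 1 ≤ 3 * (1 / q).toReal + (1 / p).toReal :=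
    not_lt.mp fun h => not_extensionBound_of_scaling hp1 hq.ne' h hE
  refine hT (mem_exponentTriangle_of_inv_le hp.ne' hq.ne' h1 h2 (not_lt.mp fun h => ?_))
  refine not_extensionBound_of_lt hp.ne' hq.ne' (fun hqt => ?_) h hE
  subst hqt
  simp only [ENNReal.div_top, ENNReal.toReal_zero] at h
  exact absurd h (not_lt.mpr ENNReal.toReal_nonneg)
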